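/- Let $k$ be a field of characteristic $0$ (for instance $\mathbb R$ or $\mathbb C$), let $F\in k[x,y,z]$ be irreducible, let $S=\{p\in k^3: F(p)=0\}$, and assume that $F=0$ is the implicit equation of $S$, i.e. every polynomial vanishing on $S$ is a multiple of $F$ (automatic for $k$ algebraically closed; for $k=\mathbb R$ it means that $S$ contains a point with $\nabla F\ne 0$). Assume that $S$ is developable in the sense that its Gaussian curvature vanishes, i.e. $$K=\begin{vmatrix}F_{xx}&F_{xy}&F_{xz}&F_x\\F_{yx}&F_{yy}&F_{yz}&F_y\\F_{zx}&F_{zy}&F_{zz}&F_z\\F_x&F_y&F_z&0\end{vmatrix}=0\quad\text{on }S$$ (it is not assumed in addition that $S$ is ruled). Then: 1. If $P_0\in k^3$ lies on every tangent plane of $S$, i.e. $\nabla F(p)\cdot(P_0-p)=0$ for all $p\in S$, then $S$ is a conical surface with apex $P_0$: it is a union of lines through $P_0$. 2. If $0\ne P_1\in k^3$ and $P_1\cdot\nabla F=0$ identically, then $S$ is a cylindrical surface with ruling direction $P_1$: it is a union of lines parallel to $P_1$. 3. If there is neither a $P_0$ as in 1 nor a $P_1$ as in 2, then $S$ is a tangential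 surface: there is an irreducible algebraic curve $\Gamma\subset k^3$, not contained in a plane, such that $S$ is the Zariski closure in $k^3$ of the union of the tangent lines of $\Gamma$ at its smooth points. Moreover, every such curve $\Gamma$ (a cuspidal edge of $S$) is contained in $\{F=F_x=F_y=F_z=0\}$. -/

import Mathlib

namespace DevelopableSurface

variable {𝕜 : Type*} [Field 𝕜]

/-- The set of points of affine 3-space at which the polynomial `F` vanishes. -/
def surface (F : MvPolynomial (Fin 3) 𝕜) : Set (Fin 3 → 𝕜) :=
  {p | MvPolynomial.eval p F = 0}

/-- `F = 0` is the implicit equation of an irreducible algebraic surface over `𝕜`: `F` is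
irreducible, and the polynomials that vanish on the set of `𝕜`-points of `F = 0` are exactly the
multiples of `F` (so that the `𝕜`-points really form a surface, unlike those of
`x ^ 2 + y ^ 2 + 1` over the reals). -/
def DefinesSurface (F : MvPolynomial (Fin 3) 𝕜) : Prop :=
  Irreducible F ∧ MvPolynomial.vanishingIdeal 𝕜 (surface F) = Ideal.span {F}

/-- The gradient `(F_x, F_y, F_z)` at the point `p`. -/
noncomputable def gradient (F : MvPolynomial (Fin 3) 𝕜) (p : Fin 3 → 𝕜) : Fin 3 → 𝕜 :=
  fun i => MvPolynomial.eval p (MvPolynomial.pderiv i F)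

open MvPolynomial in
/-- The Hessian of `F` bordered by its gradient, as a determinant. Over the reals the Gaussian
curvature of the surface `F = 0` at a regular point is, up to sign, this determinant divided by
`‖∇F‖ ^ 4`; at a singular point the determinant is zero. -/
noncomputable def curvatureDet (F : MvPolynomial (Fin 3) 𝕜) : MvPolynomial (Fin 3) 𝕜 :=
  Matrix.det
    !![pderiv 0 (pderiv 0 F), pderiv 1 (pderiv 0 F), pderiv 2 (pderiv 0 F), pderiv 0 F;
       pderiv 0 (pderiv 1 F), pderiv 1 (pderiv 1 F), pderiv 2 (pderiv 1 F), pderiv 1 F;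
       pderiv 0 (pderiv 2 F), pderiv 1 (pderiv 2 F), pderiv 2 (pderiv 2 F), pderiv 2 F;
       pderiv 0 F, pderiv 1 F, pderiv 2 F, 0]

/-- The surface `F = 0` has zero Gaussian curvature. -/
def IsDevelopable (F : MvPolynomial (Fin 3) 𝕜) : Prop :=
  ∀ p ∈ surface F, MvPolynomial.eval p (curvatureDet F) = 0

/-- The equation `T(q) = F_x(p) (q₀ - p₀) + F_y(p) (q₁ - p₁) + F_z(p) (q₂ - p₂) = 0`:
the point `q` lies on the tangent plane of `F = 0` at `p`. -/
def OnTangentPlane (F : MvPolynomial (Fin 3) 𝕜) (p q : Fin 3 → 𝕜) : Prop :=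
  gradient F p ⬝ᵥ (q - p) = 0

/-- The line through `a` with direction `d` (a line when `d ≠ 0`). -/
def line (a d : Fin 3 → 𝕜) : Set (Fin 3 → 𝕜) :=
  {p | ∃ s : 𝕜, p = a + s • d}

/-- `S` is swept out by lines that all pass through the apex `P₀`. -/
def IsConicalSurface (S : Set (Fin 3 → 𝕜)) (P₀ : Fin 3 → 𝕜) : Prop :=
  ∃ D : Set (Fin 3 → 𝕜), D.Nonempty ∧ (∀ d ∈ D, d ≠ 0) ∧ S = ⋃ d ∈ D, line P₀ d

/-- `S` is swept out by lines that are all parallel to the ruling direction `P₁`. -/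
def IsCylindricalSurface (S : Set (Fin 3 → 𝕜)) (P₁ : Fin 3 → 𝕜) : Prop :=
  P₁ ≠ 0 ∧ ∃ A : Set (Fin 3 → 𝕜), A.Nonempty ∧ S = ⋃ a ∈ A, line a P₁

/-- `Γ` is an irreducible algebraic curve in affine 3-space that lies in no plane. -/
def IsSpaceCurve (Γ : Set (Fin 3 → 𝕜)) : Prop :=
  Γ = MvPolynomial.zeroLocus 𝕜 (MvPolynomial.vanishingIdeal 𝕜 Γ) ∧
  (MvPolynomial.vanishingIdeal 𝕜 Γ).IsPrime ∧
  Algebra.trdeg 𝕜 (MvPolynomial (Fin 3) 𝕜 ⧸ MvPolynomial.vanishingIdeal 𝕜 Γ) = 1 ∧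
  ¬ ∃ (a : Fin 3 → 𝕜) (b : 𝕜), a ≠ 0 ∧ ∀ q ∈ Γ, a ⬝ᵥ q = b

/-- The Zariski tangent space of `Γ` at `q`: the vectors orthogonal at `q` to the gradients of all
polynomials that vanish on `Γ`. -/
def tangentSpace (Γ : Set (Fin 3 → 𝕜)) (q : Fin 3 → 𝕜) : Submodule 𝕜 (Fin 3 → 𝕜) where
  carrier := {v | ∀ G ∈ MvPolynomial.vanishingIdeal 𝕜 Γ, gradient G q ⬝ᵥ v = 0}
  zero_mem' := fun G _ => dotProduct_zero _
  add_mem' := fun {v w} hv hw G hG => by rw [dotProduct_add, hv G hG, hw G hG, add_zero]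
  smul_mem' := fun c v hv G hG => by rw [dotProduct_smul, hv G hG, smul_zero]

/-- The points on the tangent lines of the curve `Γ` at its smooth points, that is, at the points
where its Zariski tangent space is one-dimensional. -/
def tangentLines (Γ : Set (Fin 3 → 𝕜)) : Set (Fin 3 → 𝕜) :=
  {p | ∃ q ∈ Γ, Module.finrank 𝕜 (tangentSpace Γ q) = 1 ∧ p - q ∈ tangentSpace Γ q}

/-- `S` is the tangential surface of the space curve `Γ`: the algebraic surface defined by (that
is, the Zariski closure of the union of) the tangent lines of `Γ`. -/
def IsCuspidalEdge (Γ S : Set (Fin 3 → 𝕜)) : Prop :=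
  IsSpaceCurve Γ ∧
  S = MvPolynomial.zeroLocus 𝕜 (MvPolynomial.vanishingIdeal 𝕜 (tangentLines Γ))

/-- `S` is the tangential surface of some space curve. -/
def IsTangentialSurface (S : Set (Fin 3 → 𝕜)) : Prop :=
  ∃ Γ, IsCuspidalEdge Γ S

/-- The set `{F = F_x = F_y = F_z = 0}`. -/
def singularSet (F : MvPolynomial (Fin 3) 𝕜) : Set (Fin 3 → 𝕜) :=
  {p | MvPolynomial.eval p F = 0 ∧ gradient F p = 0}

end DevelopableSurface

/-!
Everything takes place at a generic point `x` of the surface, whose coordinates lie in its function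
field `K`. Derivations of `K` over the ground field `k` play the role of tangent vector fields, and
identities in `K` hold at all points of the surface outside a proper closed subset. Because the
points over `k` are dense, `k` is algebraically closed in `K`; because `K` has transcendence degree
at most two, an element killed by two independent derivations is therefore in `k`
(`isAlgebraic_of_derivation_eq_zero_pair`, `IsGenericPoint.exists_algebraMap_eq_of_isAlgebraic`).

*Cones and cylinders.* If all tangent planes contain `P₀`, then for reasons of degree the derivative
of `F` along the field `x - P₀` is a constant multiple of `F`. On a line through `P₀` this is
Euler's equation, whose solutions are monomials, so the line lies on the surface as soon as
one other point does. If `F` has zero derivative in the direction `P₁`, it is constant on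
lines parallel to `P₁`.

*Tangential surfaces.* A kernel vector of the bordered Hessian is a derivation `E` along which the
direction `ν` of the normal vector is constant. Let `T` be another derivation, scaled so that it
maps some coordinate of `ν` to `1`. Then `[E, T]` is a multiple of `E`, so `T` acts on the constants
of `E`, among which are `ν` and `w = ν ⬝ x`. The three equations `ν ⬝ c = w`, `ν' ⬝ c = w'`,
`ν'' ⬝ c = w''` have a solution `c`: otherwise the Wronskian of `ν` vanishes, the coordinates of `ν`
are linearly dependent over `k`, and the surface is a cylinder. Differentiating the equations shows
that `c'` is orthogonal to `ν` and `ν'`, as is `x - c`, so `x - c` is a multiple of `c'`; and `c'`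
is nonzero, since otherwise `c` is a point of `k³` on all tangent planes. Hence `x` is on the
tangent at `c` of the curve described by `c` (`IsGenericPoint.exists_focal_point`). The remaining
step is to pass from the generic point to points over `k` (`IsGenericPoint.isCuspidalEdge`).

*The edge is singular.* Let `x` now be the generic point of a cuspidal edge and `D` a nonzero
derivation of its function field. The tangents of the curve lie on `F = 0`, so `F (x + s Dx) = 0`.
Comparing the coefficients of `1, s, s², s³` with their derivatives shows that the gradient of `F`
at `x` is orthogonal to `Dx`, `D²x` and `D³x`. These are linearly independent, again by the
Wronskian, because the curve lies in no plane. So the gradient vanishes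
(`IsCuspidalEdge.subset_singularSet`).
-/

namespace DevelopableSurface

open MvPolynomial Matrix

universe u

/-! ### Cross products and linear equations in three-space -/

section Cross
variable {R : Type*} [Field R]

theorem eq_zero_of_triple_ne_zero {a b c v : Fin 3 → R} (h : a ⬝ᵥ b ⨯₃ c ≠ 0)
    (ha : a ⬝ᵥ v = 0) (hb : b ⬝ᵥ v = 0) (hc : c ⬝ᵥ v = 0) : v = 0 := by
  simp only [dotProduct, Fin.sum_univ_three, cross_apply, cons_val] at *
  ext i
  refine (mul_eq_zero.mp (?_ : _ * v i = 0)).resolve_left h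
  fin_cases i <;> simp only [Fin.zero_eta, Fin.mk_one, Fin.reduceFinMk]
  · linear_combination (b 1 * c 2 - b 2 * c 1) * ha + (c 1 * a 2 - c 2 * a 1) * hb +
      (a 1 * b 2 - a 2 * b 1) * hc
  · linear_combination (b 2 * c 0 - b 0 * c 2) * ha + (c 2 * a 0 - c 0 * a 2) * hb +
      (a 2 * b 0 - a 0 * b 2) * hc
  · linear_combination (b 0 * c 1 - b 1 * c 0) * ha + (c 0 * a 1 - c 1 * a 0) * hb +
      (a 0 * b 1 - a 1 * b 0) * hc

/-- Cramer's rule for a system of three linear equations. -/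
theorem exists_solution_of_triple_ne_zero {a b c : Fin 3 → R} (h : a ⬝ᵥ b ⨯₃ c ≠ 0)
    (r s t : R) : ∃ v : Fin 3 → R, a ⬝ᵥ v = r ∧ b ⬝ᵥ v = s ∧ c ⬝ᵥ v = t := by
  refine ⟨(a ⬝ᵥ b ⨯₃ c)⁻¹ • (r • b ⨯₃ c + s • c ⨯₃ a + t • a ⨯₃ b), ?_, ?_, ?_⟩ <;>
    rw [dotProduct_smul, smul_eq_mul, inv_mul_eq_iff_eq_mul₀ h] <;>
    simp only [dotProduct, Fin.sum_univ_three, cross_apply, cons_val, Pi.add_apply, Pi.smul_apply,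
      smul_eq_mul] <;> ring

/-- A vector whose cross product with a nonzero vector vanishes is a multiple of it. -/
theorem exists_eq_smul_of_cross_eq_zero {u v : Fin 3 → R} (hu : u ≠ 0) (h : u ⨯₃ v = 0) :
    ∃ t : R, v = t • u := by
  obtain ⟨j, hj⟩ := Function.ne_iff.mp hu
  refine ⟨v j / u j, ?_⟩
  have h0 := congrFun h 0
  have h1 := congrFun h 1
  have h2 := congrFun h 2
  simp only [cross_apply, cons_val, Pi.zero_apply] at h0 h1 h2 hj
  ext i
  rw [Pi.smul_apply, smul_eq_mul, div_mul_eq_mul_div, eq_div_iff hj]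
  fin_cases j <;> fin_cases i <;> simp only [Fin.zero_eta, Fin.mk_one, Fin.reduceFinMk] <;>
    first | ring1 | linear_combination h0 | linear_combination h1 | linear_combination h2 |
      linear_combination -h0 | linear_combination -h1 | linear_combination -h2

/-- Two vectors orthogonal to the linearly independent `a`, `b` are proportional. -/
theorem exists_eq_smul_of_orthogonal {a b u v : Fin 3 → R} (hab : a ⨯₃ b ≠ 0) (hu : u ≠ 0)
    (hau : a ⬝ᵥ u = 0) (hbu : b ⬝ᵥ u = 0) (hav : a ⬝ᵥ v = 0) (hbv : b ⬝ᵥ v = 0) :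
    ∃ t : R, v = t • u := by
  have key : ∀ w, a ⬝ᵥ w = 0 → b ⬝ᵥ w = 0 → ∃ t : R, w = t • a ⨯₃ b := fun w haw hbw => by
    refine exists_eq_smul_of_cross_eq_zero hab ?_
    rw [cross_cross_eq_smul_sub_smul, haw, hbw, zero_smul, zero_smul, sub_zero]
  obtain ⟨s, rfl⟩ := key u hau hbu
  obtain ⟨t, rfl⟩ := key v hav hbv
  have hs : s ≠ 0 := by rintro rfl; simp at hu
  exact ⟨t / s, by rw [smul_smul, div_mul_cancel₀ _ hs]⟩

theorem exists_ne_zero_orthogonal (a : Fin 3 → R) : ∃ v : Fin 3 → R, v ≠ 0 ∧ a ⬝ᵥ v = 0 := by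
  by_cases h : a 0 = 0
  · exact ⟨![1, 0, 0], fun h => by simpa using congrFun h 0,
      by simp [dotProduct, Fin.sum_univ_three, h]⟩
  · refine ⟨![-a 1, a 0, 0], fun h' => h (by simpa using congrFun h' 1), ?_⟩
    simp [dotProduct, Fin.sum_univ_three]; ring

/-- If the orthogonal complement of a set of vectors in three-space is a line, then the set
contains two independent vectors. -/
theorem exists_cross_ne_zero {W : Set (Fin 3 → R)} (v₀ : Fin 3 → R)
    (h : ∀ v, (∀ w ∈ W, w ⬝ᵥ v = 0) → ∃ t : R, v = t • v₀) :
    ∃ w₁ ∈ W, ∃ w₂ ∈ W, w₁ ⨯₃ w₂ ≠ 0 := by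
  by_contra! hW
  -- otherwise `W` lies on a line `R a`, and all vectors `a × b` lie on the line `R v₀`
  obtain ⟨a, ha, haW⟩ : ∃ a : Fin 3 → R, a ≠ 0 ∧ ∀ w ∈ W, ∃ t : R, w = t • a := by
    by_cases h0 : ∀ w ∈ W, w = 0
    · exact ⟨1, one_ne_zero, fun w hw => ⟨0, by simp [h0 w hw]⟩⟩
    · push Not at h0
      obtain ⟨a, haW, ha⟩ := h0
      exact ⟨a, ha, fun w hw => exists_eq_smul_of_cross_eq_zero ha (hW a haW w hw)⟩
  have key : ∀ b, ∃ t : R, a ⨯₃ b = t • v₀ := fun b => h _ fun w hw => by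
    obtain ⟨t, rfl⟩ := haW w hw
    rw [smul_dotProduct, dot_self_cross, smul_zero]
  have key2 : ∀ b c, (a ⨯₃ b) ⨯₃ (a ⨯₃ c) = 0 := fun b c => by
    obtain ⟨s, hs⟩ := key b
    obtain ⟨t, ht⟩ := key c
    rw [hs, ht, map_smul, map_smul, LinearMap.smul_apply, cross_self, smul_zero, smul_zero]
  obtain ⟨i, hi⟩ := Function.ne_iff.mp ha
  have e0 := congrFun (key2 ![0, 1, 0] ![0, 0, 1]) i
  have e1 := congrFun (key2 ![0, 0, 1] ![1, 0, 0]) i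
  have e2 := congrFun (key2 ![1, 0, 0] ![0, 1, 0]) i
  apply hi
  fin_cases i <;> simp [cross_apply] at e0 e1 e2 ⊢ <;> assumption

end Cross

/-! ### Derivations and Wronskians -/

section Wronskian
variable {k K : Type*} [Field k] [Field K] [Algebra k K]

/-- `D` applied to the coordinates of a vector. -/
def vecDer (D : Derivation k K K) (v : Fin 3 → K) : Fin 3 → K := fun i => D (v i)

theorem derivation_dotProduct (D : Derivation k K K) (a b : Fin 3 → K) :
    D (a ⬝ᵥ b) = a ⬝ᵥ vecDer D b + vecDer D a ⬝ᵥ b := by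
  simp only [dotProduct, Fin.sum_univ_three, vecDer, map_add, Derivation.leibniz, smul_eq_mul]
  ring

theorem derivation_div_eq_zero (D : Derivation k K K) {a b : K} (hb : b ≠ 0)
    (h : D a * b = a * D b) : D (a / b) = 0 := by
  have h1 : D (a / b * b) = D a := by rw [div_mul_cancel₀ _ hb]
  rw [Derivation.leibniz, smul_eq_mul, smul_eq_mul] at h1
  refine (mul_eq_zero.mp (?_ : b * b * D (a / b) = 0)).resolve_left (mul_ne_zero hb hb)
  have h2 : a / b * b = a := div_mul_cancel₀ _ hb
  linear_combination b * h1 + h - D b * h2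

/-- The linear dependence in the case that the first function is nonzero: the quotient `r` of the
2 × 2 Wronskians is a constant, and so is `(u₂ - r u₁) / u₀`. -/
theorem exists_constants_of_wronskian_aux (E T : Derivation k K K)
    (hET : ∀ u, E u = 0 → E (T u) = 0) {u₀ u₁ u₂ : K} (hu : u₀ ≠ 0)
    (h0 : E u₀ = 0) (h1 : E u₁ = 0) (h2 : E u₂ = 0)
    (hw : u₀ * (T u₁ * T (T u₂) - T u₂ * T (T u₁)) + u₁ * (T u₂ * T (T u₀) - T u₀ * T (T u₂)) +
      u₂ * (T u₀ * T (T u₁) - T u₁ * T (T u₀)) = 0) :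
    ∃ P₀ P₁ P₂ : K, (P₀ ≠ 0 ∨ P₁ ≠ 0 ∨ P₂ ≠ 0) ∧ (E P₀ = 0 ∧ T P₀ = 0) ∧ (E P₁ = 0 ∧ T P₁ = 0) ∧
      (E P₂ = 0 ∧ T P₂ = 0) ∧ P₀ * u₀ + P₁ * u₁ + P₂ * u₂ = 0 := by
  have hE : ∀ a b : K, E a = 0 → E b = 0 → b ≠ 0 → E (a / b) = 0 := fun a b ha hb hb0 =>
    derivation_div_eq_zero E hb0 (by rw [ha, hb]; ring)
  have E1 : ∀ D : Derivation k K K, D 1 = 0 := fun D => D.map_one_eq_zero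
  have E0 : ∀ D : Derivation k K K, D 0 = 0 := fun D => D.map_zero
  -- the 2 × 2 Wronskian of `u₀`, `u₁` and that of `u₀`, `u₂`
  set p := u₀ * T u₁ - u₁ * T u₀ with hp
  set q := u₀ * T u₂ - u₂ * T u₀ with hq
  by_cases hp0 : p = 0
  · refine ⟨-(u₁ / u₀), 1, 0, Or.inr (Or.inl one_ne_zero), ⟨?_, ?_⟩, ⟨E1 E, E1 T⟩, ⟨E0 E, E0 T⟩, ?_⟩
    · rw [map_neg, hE _ _ h1 h0 hu, neg_zero]
    · rw [map_neg, derivation_div_eq_zero T hu, neg_zero]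
      linear_combination hp0
    · field_simp; ring
  · have hEp : E p = 0 := by
      simp only [hp, map_sub, Derivation.leibniz, smul_eq_mul, h0, h1, hET _ h0, hET _ h1]; ring
    have hEq : E q = 0 := by
      simp only [hq, map_sub, Derivation.leibniz, smul_eq_mul, h0, h2, hET _ h0, hET _ h2]; ring
    set r := q / p with hr
    have hrp : r * p = q := div_mul_cancel₀ _ hp0
    have hTr : T r = 0 := by
      refine derivation_div_eq_zero T hp0 ?_
      simp only [hp, hq, map_sub, Derivation.leibniz, smul_eq_mul]
      linear_combination u₀ * hw
    have hEr : E r = 0 := hE _ _ hEq hEp hp0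
    refine ⟨-((u₂ - r * u₁) / u₀), -r, 1, Or.inr (Or.inr one_ne_zero), ⟨?_, ?_⟩, ⟨?_, ?_⟩,
      ⟨E1 E, E1 T⟩, ?_⟩
    · rw [map_neg, hE _ _ _ h0 hu, neg_zero]
      simp [Derivation.leibniz, h1, h2, hEr]
    · rw [map_neg, derivation_div_eq_zero T hu, neg_zero]
      simp only [map_sub, Derivation.leibniz, smul_eq_mul, hTr]
      linear_combination -hrp
    · rw [map_neg, hEr, neg_zero]
    · rw [map_neg, hTr, neg_zero]
    · field_simp; ring

/-- If the Wronskian of three functions vanishes, they are linearly dependent over constants. The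
functions are taken in the kernel of a derivation `E` that `T` preserves; `E = 0` is the usual
case. -/
theorem exists_constants_of_wronskian (E T : Derivation k K K)
    (hET : ∀ u, E u = 0 → E (T u) = 0) (u : Fin 3 → K) (hu : ∀ i, E (u i) = 0)
    (hw : u ⬝ᵥ vecDer T u ⨯₃ vecDer T (vecDer T u) = 0) :
    ∃ P : Fin 3 → K, P ≠ 0 ∧ (∀ i, E (P i) = 0 ∧ T (P i) = 0) ∧ P ⬝ᵥ u = 0 := by
  by_cases h : u = 0
  · exact ⟨1, one_ne_zero, fun i => ⟨E.map_one_eq_zero, T.map_one_eq_zero⟩, by simp [h]⟩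
  simp only [dotProduct, Fin.sum_univ_three, cross_apply, cons_val, vecDer] at hw ⊢
  obtain ⟨j, hj⟩ := Function.ne_iff.mp h
  fin_cases j <;> simp only [Fin.zero_eta, Fin.mk_one, Fin.reduceFinMk, Pi.zero_apply] at hj
  · obtain ⟨P₀, P₁, P₂, h, c0, c1, c2, hP⟩ := exists_constants_of_wronskian_aux E T hET hj (hu 0)
      (hu 1) (hu 2) (by linear_combination hw)
    refine ⟨![P₀, P₁, P₂], fun h' => ?_, fun i => by fin_cases i <;> assumption, ?_⟩
    · have := congrFun h' 0; have := congrFun h' 1; have := congrFun h' 2; simp_all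
    · simp only [cons_val]; linear_combination hP
  · obtain ⟨P₁, P₂, P₀, h, c1, c2, c0, hP⟩ := exists_constants_of_wronskian_aux E T hET hj (hu 1)
      (hu 2) (hu 0) (by linear_combination hw)
    refine ⟨![P₀, P₁, P₂], fun h' => ?_, fun i => by fin_cases i <;> assumption, ?_⟩
    · have := congrFun h' 0; have := congrFun h' 1; have := congrFun h' 2; simp_all
    · simp only [cons_val]; linear_combination hP
  · obtain ⟨P₂, P₀, P₁, h, c2, c0, c1, hP⟩ := exists_constants_of_wronskian_aux E T hET hj (hu 2)
      (hu 0) (hu 1) (by linear_combination hw)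
    refine ⟨![P₀, P₁, P₂], fun h' => ?_, fun i => by fin_cases i <;> assumption, ?_⟩
    · have := congrFun h' 0; have := congrFun h' 1; have := congrFun h' 2; simp_all
    · simp only [cons_val]; linear_combination hP

end Wronskian

/-! ### Derivations and transcendence degree -/

section Derivations
variable {k K : Type*} [Field k] [Field K] [Algebra k K]

theorem derivation_adjoin_eq_zero (D : Derivation k K K) {s : Set K} (hs : ∀ a ∈ s, D a = 0)
    {a : K} (ha : a ∈ Algebra.adjoin k s) : D a = 0 := by
  induction ha using Algebra.adjoin_induction with
  | mem a h => exact hs a h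
  | algebraMap r => exact D.map_algebraMap r
  | add a b _ _ ha hb => rw [map_add, ha, hb, add_zero]
  | mul a b _ _ ha hb => rw [D.leibniz, ha, hb, smul_zero, smul_zero, add_zero]

/-- In characteristic zero the field of constants of a derivation is algebraically closed in the
whole field. -/
theorem derivation_eq_zero_of_isAlgebraic [CharZero k] (D : Derivation k K K) (S : Subalgebra k K)
    (hS : ∀ a ∈ S, D a = 0) {u : K} (hu : IsAlgebraic S u) : D u = 0 := by
  have : CharZero S := charZero_of_injective_algebraMap (algebraMap k S).injective
  let D' : Derivation S K K := Derivation.mk'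
    { toFun := D
      map_add' := D.map_add
      map_smul' := fun s a => by
        rw [Subalgebra.smul_def, smul_eq_mul, D.leibniz, hS _ s.2, smul_zero, add_zero]; rfl }
    fun a b => D.leibniz a b
  -- descend to a nonzero annihilating polynomial whose derivative does not vanish at `u`
  suffices H : ∀ n (p : Polynomial S), p.natDegree = n → p ≠ 0 → Polynomial.aeval u p = 0 →
      D u = 0 by
    obtain ⟨p, hp, h⟩ := hu
    exact H _ p rfl hp h
  intro n
  induction n with
  | zero =>
    intro p hn hp h
    rw [Polynomial.eq_C_of_natDegree_eq_zero hn, Polynomial.aeval_C] at h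
    refine absurd ?_ hp
    rw [Polynomial.eq_C_of_natDegree_eq_zero hn,
      (map_eq_zero_iff _ (FaithfulSMul.algebraMap_injective S K)).mp h, Polynomial.C_0]
  | succ n ih =>
    intro p hn hp h
    by_cases hd : Polynomial.aeval u (Polynomial.derivative p) = 0
    · have hdeg : (Polynomial.derivative p).natDegree = n := by
        rw [Polynomial.natDegree_derivative, hn, Nat.add_sub_cancel]
      refine ih _ hdeg (fun h0 => ?_) hd
      rw [Polynomial.derivative_eq_zero] at h0
      omega
    · have := D'.map_aeval p u
      rw [h, map_zero, smul_eq_mul] at this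
      exact (mul_eq_zero.mp this.symm).resolve_left hd

theorem derivation_eq_zero_of_isAlgebraic_base [CharZero k] (D : Derivation k K K) {u : K}
    (hu : IsAlgebraic k u) : D u = 0 :=
  derivation_eq_zero_of_isAlgebraic D ⊥ (fun a ha => by
    obtain ⟨r, rfl⟩ := Algebra.mem_bot.mp ha
    exact D.map_algebraMap r)
    (hu.extendScalars (algebraMap k (⊥ : Subalgebra k K)).injective)

theorem derivation_eq_zero_of_isTranscendenceBasis [CharZero k] (D : Derivation k K K) {s : Set K}
    (hs : IsTranscendenceBasis k ((↑) : s → K)) (h : ∀ a ∈ s, D a = 0) : D = 0 := by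
  have := hs.isAlgebraic
  rw [Subtype.range_coe] at this
  ext u
  exact derivation_eq_zero_of_isAlgebraic D _ (fun a ha => derivation_adjoin_eq_zero D h ha)
    (this.isAlgebraic u)

theorem exists_isTranscendenceBasis_mem {u : K} (hu : Transcendental k u) :
    ∃ s : Set K, u ∈ s ∧ IsTranscendenceBasis k ((↑) : s → K) := by
  obtain ⟨s, hs, h⟩ := exists_isTranscendenceBasis_superset (R := k) (s := {u}) (by
    rw [AlgebraicIndepOn, algebraicIndependent_unique_type_iff]
    exact hu)
  exact ⟨s, hs rfl, h⟩

/-- On a field of transcendence degree one, the constants of a nonzero derivation are algebraic. -/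
theorem isAlgebraic_of_derivation_eq_zero [CharZero k] (htr : Algebra.trdeg k K ≤ 1)
    {D : Derivation k K K} (hD : D ≠ 0) {u : K} (hu : D u = 0) : IsAlgebraic k u := by
  by_contra hu'
  obtain ⟨s, hus, hs⟩ := exists_isTranscendenceBasis_mem hu'
  rw [← hs.cardinalMk_eq_trdeg, Cardinal.le_one_iff_subsingleton] at htr
  refine hD (derivation_eq_zero_of_isTranscendenceBasis D hs fun a ha => ?_)
  rw [show a = u from congrArg Subtype.val (htr.elim ⟨a, ha⟩ ⟨u, hus⟩), hu]

/-- On a field of transcendence degree one, all derivations are multiples of a nonzero one. -/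
theorem exists_derivation_eq_smul [CharZero k] (htr : Algebra.trdeg k K ≤ 1)
    {D : Derivation k K K} (hD : D ≠ 0) (D₁ : Derivation k K K) : ∃ c : K, D₁ = c • D := by
  obtain ⟨u, hu⟩ : ∃ u, D u ≠ 0 := by
    by_contra! h
    exact hD (Derivation.ext h)
  refine ⟨D₁ u / D u, ?_⟩
  by_contra h
  have := isAlgebraic_of_derivation_eq_zero htr (sub_ne_zero.mpr h) (u := u) (by
    simp [div_mul_cancel₀ _ hu])
  exact hu (derivation_eq_zero_of_isAlgebraic_base D this)

/-- On a field of transcendence degree two, the common constants of two independent derivations are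
algebraic. -/
theorem isAlgebraic_of_derivation_eq_zero_pair [CharZero k] (htr : Algebra.trdeg k K ≤ 2)
    {E T : Derivation k K K} (hET : ∀ a b : K, a • E + b • T = 0 → a = 0 ∧ b = 0) {u : K}
    (hE : E u = 0) (hT : T u = 0) : IsAlgebraic k u := by
  by_contra hu'
  obtain ⟨s, hus, hs⟩ := exists_isTranscendenceBasis_mem hu'
  rw [← hs.cardinalMk_eq_trdeg] at htr
  obtain ⟨v, hv⟩ : ∃ v, ∀ w ∈ s, w = u ∨ w = v := by
    by_contra! h
    obtain ⟨v, hvs, hvu, -⟩ := h u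
    obtain ⟨w, hws, hwu, hwv⟩ := h v
    have hinj : Function.Injective ![(⟨u, hus⟩ : s), ⟨v, hvs⟩, ⟨w, hws⟩] := by
      intro i j
      fin_cases i <;> fin_cases j <;> intro hij <;> first
        | rfl
        | exact absurd (congrArg Subtype.val hij) hvu
        | exact absurd (congrArg Subtype.val hij).symm hvu
        | exact absurd (congrArg Subtype.val hij) hwu
        | exact absurd (congrArg Subtype.val hij).symm hwu
        | exact absurd (congrArg Subtype.val hij) hwv
        | exact absurd (congrArg Subtype.val hij).symm hwv
    have := (Cardinal.lift_mk_le_lift_mk_of_injective hinj).trans (Cardinal.lift_le.mpr htr)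
    simp at this
    norm_cast at this
  have h0 : E v • T - T v • E = 0 := by
    refine derivation_eq_zero_of_isTranscendenceBasis _ hs fun a ha => ?_
    rcases hv a ha with rfl | rfl
    · simp [hE, hT]
    · simp [mul_comm]
  have h1 := hET (-T v) (E v) (by rw [← h0, neg_smul]; abel)
  have hE0 : E = 0 := derivation_eq_zero_of_isTranscendenceBasis _ hs fun a ha => by
    rcases hv a ha with rfl | rfl
    · exact hE
    · exact h1.2
  exact one_ne_zero (hET 1 0 (by simp [hE0])).1

end Derivations

/-! ### Gradients and the chain rule -/

section GradAt
variable {k K : Type*} [Field k] [Field K] [Algebra k K]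

/-- The gradient of a polynomial over `k` at a point with coordinates in an extension of `k`. -/
noncomputable def gradAt (x : Fin 3 → K) (G : MvPolynomial (Fin 3) k) : Fin 3 → K :=
  fun i => aeval x (pderiv i G)

@[simp] theorem gradAt_X (x : Fin 3 → K) (i : Fin 3) :
    gradAt x (X i : MvPolynomial (Fin 3) k) = Pi.single i 1 := by
  ext j
  by_cases h : i = j
  · subst h; simp [gradAt]
  · rw [gradAt, pderiv_X_of_ne h, Pi.single_eq_of_ne (Ne.symm h), map_zero]

theorem gradAt_C (x : Fin 3 → K) (r : k) : gradAt x (C r) = 0 := by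
  ext i; simp [gradAt]

theorem gradAt_add (x : Fin 3 → K) (G H : MvPolynomial (Fin 3) k) :
    gradAt x (G + H) = gradAt x G + gradAt x H := by
  ext i; simp [gradAt]

theorem gradAt_sub (x : Fin 3 → K) (G H : MvPolynomial (Fin 3) k) :
    gradAt x (G - H) = gradAt x G - gradAt x H := by
  ext i; simp [gradAt]

theorem gradAt_mul (x : Fin 3 → K) (G H : MvPolynomial (Fin 3) k) :
    gradAt x (G * H) = aeval x G • gradAt x H + aeval x H • gradAt x G := by
  ext i; simp [gradAt]

/-- The chain rule. -/
theorem derivation_aeval (D : Derivation k K K) (x : Fin 3 → K) (G : MvPolynomial (Fin 3) k) :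
    D (aeval x G) = gradAt x G ⬝ᵥ vecDer D x := by
  induction G using MvPolynomial.induction_on with
  | C a => simp [gradAt_C]
  | add p q hp hq => rw [map_add, map_add, gradAt_add, add_dotProduct, hp, hq]
  | mul_X p i hp =>
    rw [map_mul, D.leibniz, gradAt_mul, add_dotProduct, smul_dotProduct, smul_dotProduct, hp,
      gradAt_X, single_one_dotProduct, aeval_X]
    rfl

end GradAt

/-! ### Generic points and specialization -/

section GenericPoint
variable {k K : Type*} [Field k] [Field K] [Algebra k K]

/-- `x` is a generic point of `Z` with coordinates in the function field `K` of `Z`: the polynomial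
relations between its coordinates are the polynomials that vanish on `Z`, and every element of `K`
is a rational function of the coordinates. -/
structure IsGenericPoint (Z : Set (Fin 3 → k)) (x : Fin 3 → K) : Prop where
  aeval_eq_zero_iff (G : MvPolynomial (Fin 3) k) : aeval x G = 0 ↔ G ∈ vanishingIdeal k Z
  exists_div (u : K) : ∃ f g : MvPolynomial (Fin 3) k, aeval x g ≠ 0 ∧ u * aeval x g = aeval x f

/-- The generic point with coordinates in the fraction field of the coordinate ring. -/
theorem exists_isGenericPoint {k : Type u} [Field k] (Z : Set (Fin 3 → k))
    (hZ : (vanishingIdeal k Z : Ideal (MvPolynomial (Fin 3) k)).IsPrime) :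
    ∃ (K : Type u) (_ : Field K) (_ : Algebra k K) (x : Fin 3 → K), IsGenericPoint Z x ∧
      Algebra.EssFiniteType k K := by
  let A := MvPolynomial (Fin 3) k ⧸ (vanishingIdeal k Z : Ideal (MvPolynomial (Fin 3) k))
  let K := FractionRing A
  let φ : MvPolynomial (Fin 3) k →ₐ[k] K :=
    (IsScalarTower.toAlgHom k A K).comp (Ideal.Quotient.mkₐ k _)
  have hφ : aeval (fun i => φ (X i)) = φ := by
    ext i; simp
  have hφ' : ∀ G, φ G = algebraMap A K (Ideal.Quotient.mk _ G) := fun G => rfl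
  refine ⟨K, inferInstance, inferInstance, fun i => φ (X i), ⟨fun G => ?_, fun u => ?_⟩, ?_⟩
  · rw [hφ, hφ', map_eq_zero_iff _ (IsFractionRing.injective A K), Ideal.Quotient.eq_zero_iff_mem]
  · obtain ⟨a, b, hb, rfl⟩ := IsFractionRing.div_surjective (A := A) u
    obtain ⟨f, rfl⟩ := Ideal.Quotient.mk_surjective a
    obtain ⟨g, rfl⟩ := Ideal.Quotient.mk_surjective b
    have hg : algebraMap A K (Ideal.Quotient.mk _ g) ≠ 0 :=
      IsFractionRing.to_map_ne_zero_of_mem_nonZeroDivisors hb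
    exact ⟨f, g, by rwa [hφ, hφ'], by rw [hφ, hφ', hφ', div_mul_cancel₀ _ hg]⟩
  · have : Algebra.EssFiniteType A K := .of_isLocalization _ (nonZeroDivisors A)
    exact .comp k A K

/-- The filter of the properties that hold at the points of `Z` outside a proper closed subset. -/
def genericFilter (Z : Set (Fin 3 → k)) (x : Fin 3 → K) : Filter (Fin 3 → k) where
  sets := {U | ∃ g : MvPolynomial (Fin 3) k, aeval x g ≠ 0 ∧ ∀ p ∈ Z, eval p g ≠ 0 → p ∈ U}
  univ_sets := ⟨1, by simp, fun _ _ _ => trivial⟩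
  sets_of_superset := fun ⟨g, hg, h⟩ hUV => ⟨g, hg, fun p hp hpg => hUV (h p hp hpg)⟩
  inter_sets := fun ⟨g, hg, h⟩ ⟨g', hg', h'⟩ => ⟨g * g', by
    rw [map_mul]; exact mul_ne_zero hg hg', fun p hp hpg => by
      rw [map_mul] at hpg
      exact ⟨h p hp (left_ne_zero_of_mul hpg), h' p hp (right_ne_zero_of_mul hpg)⟩⟩

/-- `r` is the value at the point `p` of the rational function `u` of `x`. -/
def SpecializesTo (x : Fin 3 → K) (p : Fin 3 → k) (u : K) (r : k) : Prop :=
  ∃ f g : MvPolynomial (Fin 3) k, eval p g ≠ 0 ∧ u * aeval x g = aeval x f ∧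
    r * eval p g = eval p f

namespace SpecializesTo
variable {x : Fin 3 → K} {p : Fin 3 → k} {u v : K} {r s : k}

theorem aeval_eval (G : MvPolynomial (Fin 3) k) : SpecializesTo x p (aeval x G) (eval p G) :=
  ⟨G, 1, by simp, by simp, by simp⟩

theorem algebraMap (r : k) : SpecializesTo x p (algebraMap k K r) r :=
  ⟨C r, 1, by simp, by simp, by simp⟩

theorem add (hu : SpecializesTo x p u r) (hv : SpecializesTo x p v s) :
    SpecializesTo x p (u + v) (r + s) := by
  obtain ⟨f, g, hg, h1, h2⟩ := hu
  obtain ⟨f', g', hg', h1', h2'⟩ := hv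
  refine ⟨f * g' + f' * g, g * g', by rw [map_mul]; exact mul_ne_zero hg hg', ?_, ?_⟩
  · simp only [map_mul, map_add]; linear_combination aeval x g' * h1 + aeval x g * h1'
  · simp only [map_mul, map_add]; linear_combination eval p g' * h2 + eval p g * h2'

theorem mul (hu : SpecializesTo x p u r) (hv : SpecializesTo x p v s) :
    SpecializesTo x p (u * v) (r * s) := by
  obtain ⟨f, g, hg, h1, h2⟩ := hu
  obtain ⟨f', g', hg', h1', h2'⟩ := hv
  refine ⟨f * f', g * g', by rw [map_mul]; exact mul_ne_zero hg hg', ?_, ?_⟩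
  · simp only [map_mul]; linear_combination v * aeval x g' * h1 + aeval x f * h1'
  · simp only [map_mul]; linear_combination s * eval p g' * h2 + eval p f * h2'

theorem aeval {c : Fin 3 → K} {q : Fin 3 → k} (h : ∀ i, SpecializesTo x p (c i) (q i))
    (G : MvPolynomial (Fin 3) k) :
    SpecializesTo x p (MvPolynomial.aeval c G) (eval q G) := by
  induction G using MvPolynomial.induction_on with
  | C a => simpa using algebraMap (x := x) (p := p) a
  | add a b ha hb => simpa using ha.add hb
  | mul_X a i ha => simpa using ha.mul (h i)

theorem polynomial_aeval (h : SpecializesTo x p u r) (m : Polynomial k) :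
    SpecializesTo x p (Polynomial.aeval u m) (m.eval r) := by
  induction m using Polynomial.induction_on with
  | C a => simpa using algebraMap (x := x) (p := p) a
  | add a b ha hb => simpa using ha.add hb
  | monomial n a ha => simpa [pow_succ, ← mul_assoc] using ha.mul h

theorem dotProduct {c d : Fin 3 → K} {q e : Fin 3 → k}
    (h : ∀ i, SpecializesTo x p (c i) (q i)) (h' : ∀ i, SpecializesTo x p (d i) (e i)) :
    SpecializesTo x p (c ⬝ᵥ d) (q ⬝ᵥ e) := by
  simp only [_root_.dotProduct, Fin.sum_univ_three]
  exact (((h 0).mul (h' 0)).add ((h 1).mul (h' 1))).add ((h 2).mul (h' 2))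

end SpecializesTo

namespace IsGenericPoint
variable {Z : Set (Fin 3 → k)} {x : Fin 3 → K}

theorem eventually_mem : ∀ᶠ p in genericFilter Z x, p ∈ Z :=
  ⟨1, by simp, fun _ hp _ => hp⟩

variable (hx : IsGenericPoint Z x)
include hx

theorem eval_eq_zero {G : MvPolynomial (Fin 3) k} (h : aeval x G = 0) {p : Fin 3 → k}
    (hp : p ∈ Z) : eval p G = 0 := by
  simpa [coe_aeval_eq_eval] using (hx.aeval_eq_zero_iff G).mp h p hp

theorem specializesTo_unique {p : Fin 3 → k} (hp : p ∈ Z) {u : K} {r s : k}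
    (h : SpecializesTo x p u r) (h' : SpecializesTo x p u s) : r = s := by
  obtain ⟨f, g, hg, h1, h2⟩ := h
  obtain ⟨f', g', hg', h1', h2'⟩ := h'
  have := hx.eval_eq_zero (G := f * g' - f' * g) (by
    simp only [map_sub, map_mul, ← h1, ← h1']; ring) hp
  simp only [map_sub, map_mul, ← h2, ← h2'] at this
  have h3 : (r - s) * (eval p g * eval p g') = 0 := by linear_combination this
  exact sub_eq_zero.mp ((mul_eq_zero.mp h3).resolve_right (mul_ne_zero hg hg'))

theorem eq_zero_of_specializesTo {p : Fin 3 → k} (hp : p ∈ Z) {r : k}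
    (h : SpecializesTo x p 0 r) : r = 0 := by
  refine hx.specializesTo_unique hp h ?_
  simpa using SpecializesTo.algebraMap (x := x) (p := p) 0

theorem eventually_specializesTo (u : K) :
    ∀ᶠ p in genericFilter Z x, ∃ r, SpecializesTo x p u r := by
  obtain ⟨f, g, hg, h⟩ := hx.exists_div u
  exact ⟨g, hg, fun p _ hpg => ⟨eval p f / eval p g, f, g, hpg, h, div_mul_cancel₀ _ hpg⟩⟩

theorem eventually_specializesTo_vec (c : Fin 3 → K) :
    ∀ᶠ p in genericFilter Z x, ∃ q : Fin 3 → k, ∀ i, SpecializesTo x p (c i) (q i) := by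
  filter_upwards [Filter.eventually_all.mpr fun i => hx.eventually_specializesTo (c i)] with p hp
  exact Classical.axiom_of_choice hp

theorem eventually_ne_zero {u : K} (hu : u ≠ 0) :
    ∀ᶠ p in genericFilter Z x, ∀ r, SpecializesTo x p u r → r ≠ 0 := by
  filter_upwards [eventually_mem, hx.eventually_specializesTo u⁻¹] with p hp ⟨s, hs⟩ r hr h0
  have := hr.mul hs
  rw [mul_inv_cancel₀ hu, h0, zero_mul] at this
  exact one_ne_zero (hx.specializesTo_unique hp
    (by simpa using SpecializesTo.algebraMap (x := x) (p := p) 1) this)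

/-- Generic points are dense in `Z`. -/
theorem aeval_eq_zero_of_eventually {G : MvPolynomial (Fin 3) k}
    (h : ∀ᶠ p in genericFilter Z x, eval p G = 0) : aeval x G = 0 := by
  obtain ⟨g, hg, h⟩ := h
  have : aeval x (G * g) = 0 := (hx.aeval_eq_zero_iff _).mpr fun p hp => by
    by_cases hpg : eval p g = 0
    · simp [hpg]
    · simp [show eval p G = 0 from h p hp hpg]
  rw [map_mul] at this
  exact (mul_eq_zero.mp this).resolve_right hg

theorem neBot : (genericFilter Z x).NeBot := by
  refine ⟨fun h => ?_⟩
  have := hx.aeval_eq_zero_of_eventually (G := 1) (by rw [h]; exact Filter.eventually_bot)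
  simp at this

/-- Since the points of `Z` over `k` are dense, `k` is algebraically closed in the function
field. -/
theorem exists_algebraMap_eq_of_isAlgebraic {u : K} (hu : IsAlgebraic k u) :
    ∃ r, algebraMap k K r = u := by
  have := hx.neBot
  obtain ⟨p, hp, r, hr⟩ := (eventually_mem.and (hx.eventually_specializesTo u)).exists
  have h0 := hr.polynomial_aeval (minpoly k u)
  rw [minpoly.aeval] at h0
  have hroot := hx.eq_zero_of_specializesTo hp h0
  have hirr := minpoly.irreducible hu.isIntegral
  have hdeg : (minpoly k u).degree = 1 := Polynomial.degree_eq_one_of_irreducible_of_root hirr hroot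
  exact minpoly.mem_range_of_degree_eq_one k u hdeg

theorem derivation_ext {D D' : Derivation k K K} (h : ∀ i, D (x i) = D' (x i)) : D = D' := by
  ext u
  obtain ⟨f, g, hg, hu⟩ := hx.exists_div u
  have h1 := congrArg D hu
  have h2 := congrArg D' hu
  have hv : vecDer D x = vecDer D' x := funext h
  simp only [Derivation.leibniz, derivation_aeval, smul_eq_mul, hv] at h1 h2
  have : aeval x g * (D u - D' u) = 0 := by linear_combination h1 - h2
  exact sub_eq_zero.mp ((mul_eq_zero.mp this).resolve_left hg)

/-- A vector of the Zariski tangent space at the generic point extends to a derivation of the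
function field. -/
theorem exists_derivation (v : Fin 3 → K)
    (hv : ∀ G ∈ (vanishingIdeal k Z : Ideal (MvPolynomial (Fin 3) k)), gradAt x G ⬝ᵥ v = 0) :
    ∃ D : Derivation k K K, vecDer D x = v := by
  choose f g hg hfg using hx.exists_div
  -- the quotient rule; `key` is the independence of the chosen fraction
  let δ : K → K := fun u => (gradAt x (f u) ⬝ᵥ v - u * (gradAt x (g u) ⬝ᵥ v)) / aeval x (g u)
  have key : ∀ u (a b : MvPolynomial (Fin 3) k), aeval x b ≠ 0 → u * aeval x b = aeval x a →
      δ u = (gradAt x a ⬝ᵥ v - u * (gradAt x b ⬝ᵥ v)) / aeval x b := by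
    intro u a b hb hab
    have h0 : aeval x (f u * b - a * g u) = 0 := by
      simp only [map_sub, map_mul, ← hfg u, ← hab]; ring
    have h1 := hv _ ((hx.aeval_eq_zero_iff _).mp h0)
    simp only [gradAt_sub, gradAt_mul, sub_dotProduct, add_dotProduct, smul_dotProduct, smul_eq_mul,
      ← hfg u, ← hab] at h1
    simp only [δ]
    rw [div_eq_div_iff (hg u) hb]
    linear_combination h1
  have hpoly : ∀ a, δ (aeval x a) = gradAt x a ⬝ᵥ v := fun a => by
    rw [key _ a 1 (by simp) (by simp), ← C_1, gradAt_C]; simp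
  have hmul : ∀ u w, δ (u * w) = u • δ w + w • δ u := by
    intro u w
    rw [key (u * w) (f u * f w) (g u * g w) (by rw [map_mul]; exact mul_ne_zero (hg u) (hg w))
      (by simp only [map_mul, ← hfg]; ring)]
    simp only [δ, smul_eq_mul, map_mul, gradAt_mul, add_dotProduct, smul_dotProduct, ← hfg]
    have := hg u
    have := hg w
    field_simp
    ring
  let D : Derivation k K K := Derivation.mk'
    { toFun := δ
      map_add' := fun u w => by
        rw [key (u + w) (f u * g w + f w * g u) (g u * g w)
          (by rw [map_mul]; exact mul_ne_zero (hg u) (hg w))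
          (by simp only [map_mul, map_add, ← hfg]; ring)]
        simp only [δ, smul_eq_mul, map_mul, gradAt_mul, gradAt_add, add_dotProduct, smul_dotProduct,
          ← hfg]
        have := hg u
        have := hg w
        field_simp
        ring
      map_smul' := fun r u => by
        have : δ (algebraMap k K r) = 0 := by
          simpa [gradAt_C] using hpoly (C r)
        rw [Algebra.smul_def, hmul, this, smul_zero, add_zero, RingHom.id_apply, smul_eq_mul,
          Algebra.smul_def] }
    hmul
  refine ⟨D, funext fun i => ?_⟩
  have : D (x i) = gradAt x (X i : MvPolynomial (Fin 3) k) ⬝ᵥ v := by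
    rw [← hpoly, aeval_X]; rfl
  rw [vecDer, this, gradAt_X, single_one_dotProduct]

end IsGenericPoint
end GenericPoint

/-! ### Restriction of a polynomial to a line -/

section LineRestrict
variable {k K : Type*} [Field k] [Field K] [Algebra k K]

/-- The restriction of the polynomial `F` to the line through `a` with direction `d`, as a
polynomial in the parameter. -/
noncomputable def lineRestrict (F : MvPolynomial (Fin 3) k) (a d : Fin 3 → K) : Polynomial K :=
  aeval (fun i => Polynomial.C (a i) + Polynomial.C (d i) * Polynomial.X) F

theorem eval_lineRestrict (F : MvPolynomial (Fin 3) k) (a d : Fin 3 → K) (s : K) :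
    (lineRestrict F a d).eval s = aeval (a + s • d) F := by
  unfold lineRestrict
  induction F using MvPolynomial.induction_on with
  | C r => simp
  | add p q hp hq => simp [hp, hq]
  | mul_X p i hp => simp [hp, mul_comm s]

theorem derivative_lineRestrict (F : MvPolynomial (Fin 3) k) (a d : Fin 3 → K) :
    Polynomial.derivative (lineRestrict F a d) =
      ∑ i, Polynomial.C (d i) * lineRestrict (pderiv i F) a d := by
  unfold lineRestrict
  induction F using MvPolynomial.induction_on with
  | C r => simp
  | add p q hp hq => simp [hp, hq, mul_add, Finset.sum_add_distrib]
  | mul_X p j hp =>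
    have h1 : ∀ i, aeval (fun i => Polynomial.C (a i) + Polynomial.C (d i) * Polynomial.X)
        (pderiv i (X j : MvPolynomial (Fin 3) k)) = if i = j then 1 else 0 := fun i => by
      split_ifs with hij
      · rw [hij, pderiv_X_self, map_one]
      · rw [pderiv_X_of_ne (Ne.symm hij), map_zero]
    simp only [map_mul, Polynomial.derivative_mul, hp, aeval_X, pderiv_mul, map_add, h1,
      Polynomial.derivative_X, Polynomial.derivative_C]
    rw [Finset.sum_mul, eq_comm, ← sub_eq_iff_eq_add', ← Finset.sum_sub_distrib,
      Finset.sum_eq_single j (fun i _ hi => by rw [if_neg hi]; ring) (by simp), if_pos rfl]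
    ring

theorem pderiv_pderiv_comm {σ R : Type*} [CommRing R] (i j : σ) (F : MvPolynomial σ R) :
    pderiv i (pderiv j F) = pderiv j (pderiv i F) := by
  classical
  have h : ⁅(pderiv i : Derivation R (MvPolynomial σ R) (MvPolynomial σ R)),
      (pderiv j : Derivation R (MvPolynomial σ R) (MvPolynomial σ R))⁆ = 0 := by
    refine derivation_ext fun l => ?_
    rw [Derivation.commutator_apply, pderiv_X, pderiv_X, Pi.single_apply, Pi.single_apply]
    split_ifs <;> simp
  have := congrArg (fun D : Derivation R (MvPolynomial σ R) (MvPolynomial σ R) => D F) h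
  simp only [Derivation.commutator_apply, Derivation.zero_apply] at this
  exact sub_eq_zero.mp this

end LineRestrict

/-! ### Transcendence degree of a function field -/

section Trdeg
variable {k K : Type u} [Field k] [Field K] [Algebra k K]

theorem trdeg_quotient_eq_trdeg_range (c : Fin 3 → K) (I : Ideal (MvPolynomial (Fin 3) k))
    (hI : ∀ G, aeval c G = 0 ↔ G ∈ I) :
    Algebra.trdeg k (MvPolynomial (Fin 3) k ⧸ I) =
      Algebra.trdeg k (aeval c : MvPolynomial (Fin 3) k →ₐ[k] K).range := by
  obtain rfl : I = RingHom.ker (aeval c : MvPolynomial (Fin 3) k →ₐ[k] K) := by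
    ext G; rw [← hI, RingHom.mem_ker]
  exact (Ideal.quotientKerEquivRange _).trdeg_eq

theorem IsGenericPoint.isAlgebraic_range {Z : Set (Fin 3 → k)} {x : Fin 3 → K}
    (hx : IsGenericPoint Z x) :
    Algebra.IsAlgebraic (aeval x : MvPolynomial (Fin 3) k →ₐ[k] K).range K := by
  refine ⟨fun u => ?_⟩
  obtain ⟨f, g, hg, h⟩ := hx.exists_div u
  let F : (aeval x : MvPolynomial (Fin 3) k →ₐ[k] K).range := ⟨aeval x f, f, rfl⟩
  let G : (aeval x : MvPolynomial (Fin 3) k →ₐ[k] K).range := ⟨aeval x g, g, rfl⟩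
  refine ⟨Polynomial.C G * Polynomial.X - Polynomial.C F, fun h0 => hg ?_, ?_⟩
  · have := congrArg (fun p => Polynomial.coeff p 1) h0
    exact congrArg Subtype.val (show G = 0 by simpa [Polynomial.coeff_C] using this)
  · have h1 : algebraMap (aeval x : MvPolynomial (Fin 3) k →ₐ[k] K).range K G = aeval x g := rfl
    have h2 : algebraMap (aeval x : MvPolynomial (Fin 3) k →ₐ[k] K).range K F = aeval x f := rfl
    simp only [map_sub, map_mul, Polynomial.aeval_C, Polynomial.aeval_X, h1, h2, ← h]
    ring

theorem IsGenericPoint.trdeg_eq {Z : Set (Fin 3 → k)} {x : Fin 3 → K} (hx : IsGenericPoint Z x) :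
    Algebra.trdeg k K =
      Algebra.trdeg k (MvPolynomial (Fin 3) k ⧸ (vanishingIdeal k Z : Ideal _)) := by
  rw [trdeg_quotient_eq_trdeg_range x _ hx.aeval_eq_zero_iff]
  have := hx.isAlgebraic_range
  rw [← trdeg_add_eq k (aeval x : MvPolynomial (Fin 3) k →ₐ[k] K).range (A := K),
    trdeg_eq_zero (R := (aeval x : MvPolynomial (Fin 3) k →ₐ[k] K).range), add_zero]

/-- A transcendental finitely generated extension in characteristic zero has a nonzero derivation,
since it has a nonzero module of differentials. -/
theorem exists_derivation_ne_zero [CharZero k] [Algebra.EssFiniteType k K]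
    (h : Algebra.trdeg k K ≠ 0) : ∃ D : Derivation k K K, D ≠ 0 := by
  by_contra! hD
  have hsub : Subsingleton (KaehlerDifferential k K) := by
    refine ⟨fun a b => sub_eq_zero.mp ?_⟩
    rw [← Module.forall_dual_apply_eq_zero_iff K]
    intro φ
    have : φ = 0 := (KaehlerDifferential.linearMapEquivDerivation k K).injective
      (by rw [hD (KaehlerDifferential.linearMapEquivDerivation k K φ), map_zero])
    rw [this, LinearMap.zero_apply]
  have hu : Algebra.FormallyUnramified k K := ⟨hsub⟩
  have hs := Algebra.FormallyUnramified.isSeparable k K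
  exact h trdeg_eq_zero

end Trdeg

/-! ### Tangent spaces of curves -/

section Curve
variable {k K : Type*} [Field k] [Field K] [Algebra k K]

theorem map_crossProduct {R S : Type*} [CommRing R] [CommRing S] (f : R →+* S) (a b : Fin 3 → R)
    (i : Fin 3) : f ((a ⨯₃ b) i) = ((fun j => f (a j)) ⨯₃ (fun j => f (b j))) i := by
  fin_cases i <;> simp [cross_apply]

theorem IsGenericPoint.eq_zero_of_eventually {Z : Set (Fin 3 → k)} {x : Fin 3 → K}
    (hx : IsGenericPoint Z x) {u : K} (h : ∀ᶠ p in genericFilter Z x, SpecializesTo x p u 0) :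
    u = 0 := by
  by_contra hu
  have := hx.neBot
  obtain ⟨p, h1, h2⟩ := (h.and (hx.eventually_ne_zero hu)).exists
  exact h2 0 h1 rfl

/-- The value of a derivation of the function field at a point is a tangent vector. -/
theorem IsGenericPoint.mem_tangentSpace {Z : Set (Fin 3 → k)} {x : Fin 3 → K}
    (hx : IsGenericPoint Z x) (D : Derivation k K K) {p r : Fin 3 → k} (hp : p ∈ Z)
    (hr : ∀ i, SpecializesTo x p (vecDer D x i) (r i)) : r ∈ tangentSpace Z p := by
  intro G hG
  have h : SpecializesTo x p (gradAt x G ⬝ᵥ vecDer D x) (gradient G p ⬝ᵥ r) :=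
    SpecializesTo.dotProduct (fun i => SpecializesTo.aeval_eval _) hr
  rw [← derivation_aeval, (hx.aeval_eq_zero_iff G).mpr hG, map_zero] at h
  exact hx.eq_zero_of_specializesTo hp h

theorem finrank_tangentSpace_eq_one {Z : Set (Fin 3 → k)} {p r : Fin 3 → k}
    {G₁ G₂ : MvPolynomial (Fin 3) k} (hG₁ : G₁ ∈ vanishingIdeal k Z) (hG₂ : G₂ ∈ vanishingIdeal k Z)
    (h : gradient G₁ p ⨯₃ gradient G₂ p ≠ 0) (hr : r ≠ 0) (hrp : r ∈ tangentSpace Z p) :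
    Module.finrank k (tangentSpace Z p) = 1 := by
  refine finrank_eq_one_iff'.mpr ⟨⟨r, hrp⟩, fun h0 => hr (congrArg Subtype.val h0), fun w => ?_⟩
  obtain ⟨t, ht⟩ := exists_eq_smul_of_orthogonal h hr (hrp _ hG₁) (hrp _ hG₂) (w.2 _ hG₁)
    (w.2 _ hG₂)
  exact ⟨t, Subtype.ext ht.symm⟩

/-- The gradients of two polynomials of the ideal span the normal space at a smooth point of a
curve. -/
theorem exists_gradient_cross_ne_zero {Z : Set (Fin 3 → k)} {p : Fin 3 → k}
    (h : Module.finrank k (tangentSpace Z p) = 1) :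
    ∃ G₁ ∈ (vanishingIdeal k Z : Ideal (MvPolynomial (Fin 3) k)),
      ∃ G₂ ∈ (vanishingIdeal k Z : Ideal (MvPolynomial (Fin 3) k)),
        gradient G₁ p ⨯₃ gradient G₂ p ≠ 0 := by
  obtain ⟨v₀, -, hv⟩ := finrank_eq_one_iff'.mp h
  let W : Set (Fin 3 → k) :=
    {w | ∃ G ∈ (vanishingIdeal k Z : Ideal (MvPolynomial (Fin 3) k)), gradient G p = w}
  have key : ∀ v, (∀ w ∈ W, w ⬝ᵥ v = 0) → ∃ t : k, v = t • (v₀ : Fin 3 → k) := fun v hw => by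
    have hvt : v ∈ tangentSpace Z p := fun G hG => hw (gradient G p) ⟨G, hG, rfl⟩
    obtain ⟨t, ht⟩ := hv ⟨v, hvt⟩
    exact ⟨t, (congrArg Subtype.val ht).symm⟩
  obtain ⟨_, ⟨G₁, h₁, rfl⟩, _, ⟨G₂, h₂, rfl⟩, h⟩ := exists_cross_ne_zero _ key
  exact ⟨G₁, h₁, G₂, h₂, h⟩

end Curve

/-! ### Space curves and their cuspidal singularities -/

section SpaceCurve
variable {k K : Type u} [Field k] [Field K] [Algebra k K]

/-- Generic smoothness of a curve in characteristic zero. -/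
theorem IsGenericPoint.eventually_smooth [CharZero k] {Z : Set (Fin 3 → k)} {x : Fin 3 → K}
    (hx : IsGenericPoint Z x) (htr : Algebra.trdeg k K ≤ 1) {D : Derivation k K K} (hD : D ≠ 0) :
    ∀ᶠ p in genericFilter Z x, Module.finrank k (tangentSpace Z p) = 1 := by
  have hDx : vecDer D x ≠ 0 := fun h => hD (hx.derivation_ext fun i => by
    rw [Derivation.zero_apply]; exact congrFun h i)
  let W : Set (Fin 3 → K) :=
    {w | ∃ G ∈ (vanishingIdeal k Z : Ideal (MvPolynomial (Fin 3) k)), gradAt x G = w}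
  have key : ∀ v, (∀ w ∈ W, w ⬝ᵥ v = 0) → ∃ t : K, v = t • vecDer D x := fun v hv => by
    obtain ⟨D₁, rfl⟩ := hx.exists_derivation v fun G hG => hv (gradAt x G) ⟨G, hG, rfl⟩
    obtain ⟨c, rfl⟩ := exists_derivation_eq_smul htr hD D₁
    exact ⟨c, rfl⟩
  obtain ⟨_, ⟨G₁, hG₁, rfl⟩, _, ⟨G₂, hG₂, rfl⟩, h⟩ := exists_cross_ne_zero _ key
  obtain ⟨i, hi⟩ := Function.ne_iff.mp h
  obtain ⟨j, hj⟩ := Function.ne_iff.mp hDx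
  have hM := map_crossProduct (aeval x : MvPolynomial (Fin 3) k →ₐ[k] K).toRingHom
    (fun i => pderiv i G₁) (fun i => pderiv i G₂) i
  have hi' : aeval x (((fun i => pderiv i G₁) ⨯₃ (fun i => pderiv i G₂)) i) ≠ 0 := by
    intro h0; exact hi (hM.symm.trans h0)
  filter_upwards [eventually_mem, hx.eventually_specializesTo_vec (vecDer D x),
    hx.eventually_ne_zero hj, hx.eventually_ne_zero hi'] with p hp ⟨r, hr⟩ hrj hci
  refine finrank_tangentSpace_eq_one hG₁ hG₂ (fun h0 => ?_) (fun h0 => hrj _ (hr j) (congrFun h0 j))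
    (hx.mem_tangentSpace D hp hr)
  refine hci _ (SpecializesTo.aeval_eval _) ?_
  rw [map_crossProduct]
  exact congrFun h0 i

theorem dotProduct_algebraMap_eq_aeval (x : Fin 3 → K) (a : Fin 3 → k) :
    (fun i => algebraMap k K (a i)) ⬝ᵥ x = aeval x (∑ i, C (a i) * X i) := by
  simp [dotProduct]

theorem IsGenericPoint.exists_plane {Z : Set (Fin 3 → k)} {x : Fin 3 → K}
    (hx : IsGenericPoint Z x) {a : Fin 3 → k} {b : k}
    (h : (fun i => algebraMap k K (a i)) ⬝ᵥ x = algebraMap k K b) : ∀ q ∈ Z, a ⬝ᵥ q = b := by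
  intro q hq
  have := hx.eval_eq_zero (G := ∑ i, C (a i) * X i - C b) (by
    rw [map_sub, ← dotProduct_algebraMap_eq_aeval, h]; simp) hq
  simpa [sub_eq_zero, dotProduct] using this

/-- The derivatives of the coordinates of a curve that lies in no plane have nonzero Wronskian. -/
theorem IsGenericPoint.wronskian_ne_zero [CharZero k] {Z : Set (Fin 3 → k)} {x : Fin 3 → K}
    (hx : IsGenericPoint Z x) (htr : Algebra.trdeg k K ≤ 1) {D : Derivation k K K} (hD : D ≠ 0)
    (hZ : ¬ ∃ (a : Fin 3 → k) (b : k), a ≠ 0 ∧ ∀ q ∈ Z, a ⬝ᵥ q = b) :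
    vecDer D x ⬝ᵥ vecDer D (vecDer D x) ⨯₃ vecDer D (vecDer D (vecDer D x)) ≠ 0 := by
  intro hw
  obtain ⟨P, hP, hPc, hPx⟩ := exists_constants_of_wronskian 0 D (fun _ _ => rfl) (vecDer D x)
    (fun _ => rfl) hw
  have hconst : ∀ u, D u = 0 → ∃ r, algebraMap k K r = u := fun u hu =>
    hx.exists_algebraMap_eq_of_isAlgebraic (isAlgebraic_of_derivation_eq_zero htr hD hu)
  choose a ha using fun i => hconst (P i) (hPc i).2
  obtain rfl : (fun i => algebraMap k K (a i)) = P := funext ha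
  obtain ⟨b, hb⟩ := hconst ((fun i => algebraMap k K (a i)) ⬝ᵥ x) (by
    have : vecDer D (fun i => algebraMap k K (a i)) = 0 := funext fun i => (hPc i).2
    rw [derivation_dotProduct, hPx, this, zero_dotProduct, add_zero])
  exact hZ ⟨a, b, fun h0 => hP (by simp [h0]; rfl), hx.exists_plane hb.symm⟩

/-- If the tangent lines `x + s Dx` at the generic point of a curve lie on `F = 0`, then the
gradient of `F` is orthogonal to the first three derivatives of `x`. This compares the Taylor
expansion of `F (x + s Dx)` in `s` to third order with the derivatives of its coefficients. -/
theorem gradAt_orthogonal_of_lineRestrict_eq_zero [CharZero k] (D : Derivation k K K)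
    (x : Fin 3 → K) (F : MvPolynomial (Fin 3) k) (h : lineRestrict F x (vecDer D x) = 0) :
    gradAt x F ⬝ᵥ vecDer D x = 0 ∧ gradAt x F ⬝ᵥ vecDer D (vecDer D x) = 0 ∧
      gradAt x F ⬝ᵥ vecDer D (vecDer D (vecDer D x)) = 0 := by
  have : CharZero K := charZero_of_injective_algebraMap (algebraMap k K).injective
  set v := vecDer D x with hv
  have h1 := congrArg Polynomial.derivative h
  rw [derivative_lineRestrict, Polynomial.derivative_zero] at h1
  have h2 := congrArg Polynomial.derivative h1
  simp only [Polynomial.derivative_sum, Polynomial.derivative_C_mul, derivative_lineRestrict,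
    Polynomial.derivative_zero] at h2
  have h3 := congrArg Polynomial.derivative h2
  simp only [Polynomial.derivative_sum, Polynomial.derivative_C_mul, derivative_lineRestrict,
    Polynomial.derivative_zero] at h3
  have e1 := congrArg (Polynomial.eval 0) h1
  have e2 := congrArg (Polynomial.eval 0) h2
  have e3 := congrArg (Polynomial.eval 0) h3
  simp only [Polynomial.eval_finsetSum, Polynomial.eval_mul, Polynomial.eval_C, eval_lineRestrict,
    zero_smul, add_zero, Polynomial.eval_zero] at e1 e2 e3
  -- `a`, `a'`, `a''` are the gradient of `F` at `x` and its derivatives along the curve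
  set a := gradAt x F with ha
  have ha1 : ∀ i, vecDer D a i = gradAt x (pderiv i F) ⬝ᵥ v := fun i => derivation_aeval D x _
  have ha2 : ∀ i, vecDer D (vecDer D a) i =
      gradAt x (pderiv i F) ⬝ᵥ vecDer D v + vecDer D (gradAt x (pderiv i F)) ⬝ᵥ v := fun i => by
    rw [vecDer, ha1, derivation_dotProduct]
  have ha3 : ∀ i j, vecDer D (gradAt x (pderiv i F)) j = gradAt x (pderiv j (pderiv i F)) ⬝ᵥ v :=
    fun i j => derivation_aeval D x _
  have f1 : a ⬝ᵥ v = 0 := by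
    rw [← e1, dotProduct]
    exact Finset.sum_congr rfl fun _ _ => mul_comm _ _
  have f2 : vecDer D a ⬝ᵥ v = 0 := by
    rw [← e2]
    simp only [dotProduct, ha1, Fin.sum_univ_three, gradAt]
    ring
  have f3 : a ⬝ᵥ vecDer D v = 0 := by
    have := derivation_dotProduct D a v
    rw [f1, map_zero, f2, add_zero] at this
    exact this.symm
  have hsymm : ∀ i j, gradAt x (pderiv i F) j = gradAt x (pderiv j F) i := fun i j => by
    rw [gradAt, gradAt, pderiv_pderiv_comm]
  have f4 : vecDer D (vecDer D a) ⬝ᵥ v = vecDer D a ⬝ᵥ vecDer D v := by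
    simp only [dotProduct, Fin.sum_univ_three, ha2, ha1, ha3]
    simp only [Fin.sum_univ_three] at e3
    rw [hsymm 1 0, hsymm 2 0, hsymm 2 1]
    simp only [gradAt] at e3 ⊢
    linear_combination e3
  have f5 : vecDer D a ⬝ᵥ vecDer D v = 0 := by
    have := derivation_dotProduct D (vecDer D a) v
    rw [f2, map_zero, f4, ← two_mul] at this
    exact (mul_eq_zero.mp this.symm).resolve_left two_ne_zero
  have f6 : a ⬝ᵥ vecDer D (vecDer D v) = 0 := by
    have := derivation_dotProduct D a (vecDer D v)
    rw [f3, map_zero, f5, add_zero] at this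
    exact this.symm
  exact ⟨f1, f3, f6⟩

theorem lineRestrict_eq_zero [CharZero k] {F : MvPolynomial (Fin 3) k} {a d : Fin 3 → K}
    (h : ∀ s : k, aeval (a + algebraMap k K s • d) F = 0) : lineRestrict F a d = 0 := by
  refine Polynomial.eq_zero_of_infinite_isRoot _
    ((Set.infinite_range_of_injective (algebraMap k K).injective).mono ?_)
  rintro _ ⟨s, rfl⟩
  exact (eval_lineRestrict F a d _).trans (h s)

/-- The points of a cuspidal edge are singular points of its tangential surface. -/
theorem IsCuspidalEdge.subset_singularSet [CharZero k] {F : MvPolynomial (Fin 3) k}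
    {Γ : Set (Fin 3 → k)} (hΓ : IsCuspidalEdge Γ (surface F)) :
    Γ ⊆ singularSet F := by
  obtain ⟨⟨-, hprime, htr, hplane⟩, hS⟩ := hΓ
  have hlines : tangentLines Γ ⊆ surface F := by
    rw [hS]; exact zeroLocus_vanishingIdeal_le _
  obtain ⟨K, _, _, x, hx, hfin⟩ := exists_isGenericPoint Γ hprime
  rw [← hx.trdeg_eq] at htr
  obtain ⟨D, hD⟩ := exists_derivation_ne_zero (k := k) (K := K) (by rw [htr]; exact one_ne_zero)
  have hline : lineRestrict F x (vecDer D x) = 0 := by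
    refine lineRestrict_eq_zero fun s => hx.eq_zero_of_eventually ?_
    filter_upwards [IsGenericPoint.eventually_mem, hx.eventually_smooth htr.le hD,
      hx.eventually_specializesTo_vec (vecDer D x)] with p hp hsm ⟨r, hr⟩
    have hmem : p + s • r ∈ tangentLines Γ := ⟨p, hp, hsm, by
      rw [add_sub_cancel_left]
      exact (tangentSpace Γ p).smul_mem s (hx.mem_tangentSpace D hp hr)⟩
    rw [← show eval (p + s • r) F = 0 from hlines hmem]
    refine SpecializesTo.aeval (fun i => ?_) F
    have hxi : SpecializesTo x p (x i) (p i) := by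
      simpa using SpecializesTo.aeval_eval (x := x) (p := p) (X i)
    exact hxi.add ((SpecializesTo.algebraMap s).mul (hr i))
  obtain ⟨h1, h2, h3⟩ := gradAt_orthogonal_of_lineRestrict_eq_zero D x F hline
  rw [dotProduct_comm] at h1 h2 h3
  have hgrad := eq_zero_of_triple_ne_zero (hx.wronskian_ne_zero htr.le hD hplane) h1 h2 h3
  have hFx : aeval x F = 0 := by
    have := eval_lineRestrict F x (vecDer D x) 0
    rw [hline, zero_smul, add_zero, Polynomial.eval_zero] at this
    exact this.symm
  have hFi : ∀ i, aeval x (pderiv i F) = 0 := fun i => congrFun hgrad i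
  intro q hq
  refine ⟨hx.eval_eq_zero hFx hq, ?_⟩
  ext i
  change eval q (pderiv i F) = 0
  exact hx.eval_eq_zero (hFi i) hq

end SpaceCurve

/-! ### Degrees of partial derivatives -/

section Degree
variable {k : Type*} [Field k]

theorem degree_lt_totalDegree_of_mem_support_pderiv {F : MvPolynomial (Fin 3) k} {i : Fin 3}
    {m : Fin 3 →₀ ℕ} (hm : m ∈ (pderiv i F).support) :
    (m.sum fun _ e => e) < F.totalDegree := by
  have h : m + Finsupp.single i 1 ∈ F.support := by
    rw [mem_support_iff, coeff_pderiv] at hm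
    exact mem_support_iff.mpr (left_ne_zero_of_mul hm)
  have := le_totalDegree h
  rw [Finsupp.sum_add_index' (fun _ => rfl) (fun _ _ _ => rfl), Finsupp.sum_single_index rfl]
    at this
  omega

theorem totalDegree_pderiv_lt {F : MvPolynomial (Fin 3) k} {i : Fin 3} (h : pderiv i F ≠ 0) :
    (pderiv i F).totalDegree < F.totalDegree := by
  obtain ⟨m, hm⟩ := support_nonempty.mpr h
  have hpos := degree_lt_totalDegree_of_mem_support_pderiv hm
  exact (Finset.sup_lt_iff (by simp only [Nat.bot_eq_zero]; omega)).mpr fun m hm =>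
    degree_lt_totalDegree_of_mem_support_pderiv hm

/-- A directional derivative of `F` that is a multiple of `F` vanishes, for reasons of degree. -/
theorem sum_C_mul_pderiv_eq_zero_of_dvd {F : MvPolynomial (Fin 3) k} (a : Fin 3 → k)
    (h : F ∣ ∑ i, C (a i) * pderiv i F) : ∑ i, C (a i) * pderiv i F = 0 := by
  by_contra h0
  obtain ⟨q, hq⟩ := h
  have hF : F ≠ 0 := by rintro rfl; simp at h0
  have hq0 : q ≠ 0 := by rintro rfl; exact h0 (by rw [hq, mul_zero])
  have hdeg : ∀ m ∈ (∑ i, C (a i) * pderiv i F).support,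
      (m.sum fun _ e => e) < F.totalDegree := fun m hm => by
    rw [mem_support_iff, coeff_sum] at hm
    obtain ⟨i, -, hi⟩ := Finset.exists_ne_zero_of_sum_ne_zero hm
    rw [coeff_C_mul] at hi
    exact degree_lt_totalDegree_of_mem_support_pderiv
      (mem_support_iff.mpr (right_ne_zero_of_mul hi))
  obtain ⟨m, hm⟩ := support_nonempty.mpr h0
  have hpos := hdeg m hm
  have hlt : (∑ i, C (a i) * pderiv i F).totalDegree < F.totalDegree :=
    (Finset.sup_lt_iff (by simp only [Nat.bot_eq_zero]; omega)).mpr hdeg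
  rw [hq, totalDegree_mul_of_isDomain hF hq0] at hlt
  omega

/-- If the derivative of `F` along the vector field `x - P` is a multiple of `F`, then the factor
is a constant. -/
theorem exists_C_of_dvd_sum_pderiv_mul {F : MvPolynomial (Fin 3) k} (hF : F ≠ 0) (P : Fin 3 → k)
    (h : F ∣ ∑ i, pderiv i F * (X i - C (P i))) :
    ∃ e : k, ∑ i, pderiv i F * (X i - C (P i)) = C e * F := by
  obtain ⟨q, hq⟩ := h
  suffices hq0 : q.totalDegree = 0 by
    exact ⟨coeff 0 q, by rw [hq, mul_comm, ← totalDegree_eq_zero_iff_eq_C.mp hq0]⟩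
  by_cases hq1 : q = 0
  · rw [hq1, totalDegree_zero]
  have hle : (∑ i, pderiv i F * (X i - C (P i))).totalDegree ≤ F.totalDegree := by
    refine totalDegree_finsetSum_le fun i _ => ?_
    by_cases h0 : pderiv i F = 0
    · rw [h0, zero_mul, totalDegree_zero]; exact Nat.zero_le _
    · have h1 : (X i - C (P i) : MvPolynomial (Fin 3) k).totalDegree ≤ 1 :=
        (totalDegree_sub_C_le _ _).trans (totalDegree_X i).le
      have := totalDegree_pderiv_lt h0
      exact (totalDegree_mul _ _).trans (by omega)
  rw [hq, totalDegree_mul_of_isDomain hF hq1] at hle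
  omega

end Degree

/-! ### Cones and cylinders -/

section ConesAndCylinders
variable {k : Type*} [Field k] {F : MvPolynomial (Fin 3) k}

theorem mem_surface {p : Fin 3 → k} : p ∈ surface F ↔ eval p F = 0 := Iff.rfl

theorem DefinesSurface.mem_vanishingIdeal_iff (hF : DefinesSurface F)
    {G : MvPolynomial (Fin 3) k} : G ∈ vanishingIdeal k (surface F) ↔ F ∣ G := by
  rw [hF.2, Ideal.mem_span_singleton]

theorem DefinesSurface.dvd_of_forall_eval_eq_zero (hF : DefinesSurface F)
    {G : MvPolynomial (Fin 3) k} (h : ∀ p ∈ surface F, eval p G = 0) : F ∣ G :=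
  hF.mem_vanishingIdeal_iff.mp fun p hp => by simpa using h p hp

theorem DefinesSurface.nonempty (hF : DefinesSurface F) : (surface F).Nonempty := by
  by_contra h
  rw [Set.not_nonempty_iff_eq_empty] at h
  exact hF.1.not_isUnit (isUnit_of_dvd_one (hF.dvd_of_forall_eval_eq_zero (G := 1) (by simp [h])))

/-- A surface has more than one point, since two coordinates have no common factor. -/
theorem DefinesSurface.exists_ne (hF : DefinesSurface F) (P : Fin 3 → k) :
    ∃ p ∈ surface F, p ≠ P := by
  by_contra! h
  have hdvd : ∀ i, F ∣ X i - C (P i) := fun i =>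
    hF.dvd_of_forall_eval_eq_zero fun p hp => by simp [h p hp]
  obtain ⟨q, hq⟩ := hdvd 0
  have hX : (X 0 - C (P 0) : MvPolynomial (Fin 3) k) ≠ 0 := fun h0 => by
    have := congrArg (eval (P + 1)) h0
    simp at this
  have hq0 : q ≠ 0 := by rintro rfl; exact hX (by rw [hq, mul_zero])
  have hdeg : F.totalDegree + q.totalDegree ≤ 1 := by
    rw [← totalDegree_mul_of_isDomain hF.1.ne_zero hq0, ← hq]
    exact (totalDegree_sub_C_le _ _).trans (totalDegree_X 0).le
  have hF1 : F.totalDegree ≠ 0 := fun h0 => hF.1.not_isUnit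
    (isUnit_iff_totalDegree_of_isReduced.mpr ⟨by
      rw [isUnit_iff_ne_zero]
      intro hc
      exact hF.1.ne_zero (by rw [totalDegree_eq_zero_iff_eq_C.mp h0, hc, C_0]), h0⟩)
  have hqC := totalDegree_eq_zero_iff_eq_C.mp (show q.totalDegree = 0 by omega)
  have hc : coeff 0 q ≠ 0 := fun h0 => hq0 (by rw [hqC, h0, C_0])
  obtain ⟨r, hr⟩ := hdvd 1
  let p : Fin 3 → k := ![P 0, P 1 + 1, P 2]
  have h0 := congrArg (eval p) hq
  have h1 := congrArg (eval p) hr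
  rw [hqC] at h0
  simp only [map_sub, eval_X, eval_C, map_mul, p, cons_val_zero, cons_val_one, sub_self,
    add_sub_cancel_left] at h0 h1
  rw [(mul_eq_zero.mp h0.symm).resolve_right hc, zero_mul] at h1
  exact one_ne_zero h1

/-- A surface all of whose tangent planes pass through `P₀` is a cone: restricted to a line through
`P₀`, its equation satisfies Euler's relation `s f' = e f`, so `f` is a monomial. -/
theorem isConicalSurface_of_onTangentPlane [CharZero k] (hF : DefinesSurface F) (P₀ : Fin 3 → k)
    (h : ∀ p ∈ surface F, OnTangentPlane F p P₀) : IsConicalSurface (surface F) P₀ := by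
  obtain ⟨e, he⟩ := exists_C_of_dvd_sum_pderiv_mul hF.1.ne_zero P₀
    (hF.dvd_of_forall_eval_eq_zero fun p hp => by
      have := h p hp
      simp only [OnTangentPlane, dotProduct, gradient, Pi.sub_apply] at this
      rw [← neg_eq_zero, ← this]
      simp only [map_sum, map_mul, map_sub, eval_X, eval_C, ← Finset.sum_neg_distrib]
      exact Finset.sum_congr rfl fun i _ => by ring)
  have hline : ∀ p ∈ surface F, ∀ s : k, P₀ + s • (p - P₀) ∈ surface F := by
    intro p hp s
    set f := lineRestrict F P₀ (p - P₀) with hf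
    have heuler : Polynomial.X * Polynomial.derivative f = Polynomial.C e * f := by
      have := congrArg (fun G => lineRestrict G P₀ (p - P₀)) he
      simp only [lineRestrict, map_sum, map_mul, map_sub, aeval_X, algHom_C,
        Polynomial.algebraMap_apply, Algebra.algebraMap_self, RingHom.id_apply] at this
      rw [hf, derivative_lineRestrict, Finset.mul_sum]
      simp only [lineRestrict]
      rw [← this]
      refine Finset.sum_congr rfl fun i _ => ?_
      simp only [Pi.sub_apply, map_sub]
      ring
    have hcoeff : ∀ n : ℕ, (n : k) * f.coeff n = e * f.coeff n := fun n => by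
      have := congrArg (fun g => Polynomial.coeff g n) heuler
      rw [Polynomial.coeff_C_mul] at this
      rw [← this]
      cases n with
      | zero => simp
      | succ n => rw [Polynomial.coeff_X_mul, Polynomial.coeff_derivative]; push_cast; ring
    have hf1 : f.eval 1 = 0 := by
      rw [hf, eval_lineRestrict, one_smul, add_sub_cancel]
      simpa using mem_surface.mp hp
    have hf0 : f = 0 := by
      by_contra h0
      have hlead : f.leadingCoeff ≠ 0 := Polynomial.leadingCoeff_ne_zero.mpr h0
      have hmono : f = Polynomial.monomial f.natDegree f.leadingCoeff := by
        ext n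
        rw [Polynomial.coeff_monomial]
        split_ifs with hn
        · rw [← hn]; rfl
        · by_contra hcn
          have h1 := mul_right_cancel₀ hcn (hcoeff n)
          have h2 := mul_right_cancel₀ hlead (hcoeff f.natDegree)
          exact hn (Nat.cast_injective (h2.trans h1.symm))
      rw [hmono, Polynomial.eval_monomial, one_pow, mul_one] at hf1
      exact hlead hf1
    have := eval_lineRestrict F P₀ (p - P₀) s
    rw [← hf, hf0, Polynomial.eval_zero] at this
    simpa [mem_surface] using this.symm
  refine ⟨{d | d ≠ 0 ∧ ∀ s : k, P₀ + s • d ∈ surface F}, ?_, fun d hd => hd.1, ?_⟩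
  · obtain ⟨p, hp, hne⟩ := hF.exists_ne P₀
    exact ⟨p - P₀, sub_ne_zero.mpr hne, hline p hp⟩
  · ext p
    simp only [Set.mem_iUnion, line, Set.mem_ofPred_eq, exists_prop]
    refine ⟨fun hp => ?_, ?_⟩
    · by_cases hpP : p = P₀
      · obtain ⟨q, hq, hne⟩ := hF.exists_ne P₀
        exact ⟨q - P₀, ⟨sub_ne_zero.mpr hne, hline q hq⟩, 0, by simp [hpP]⟩
      · exact ⟨p - P₀, ⟨sub_ne_zero.mpr hpP, hline p hp⟩, 1, by simp⟩
    · rintro ⟨d, ⟨-, hd⟩, s, rfl⟩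
      exact hd s

theorem isCylindricalSurface_of_sum_pderiv_eq_zero [CharZero k] (hF : DefinesSurface F)
    (P₁ : Fin 3 → k) (hP₁ : P₁ ≠ 0) (h : ∑ i, C (P₁ i) * pderiv i F = 0) :
    IsCylindricalSurface (surface F) P₁ := by
  refine ⟨hP₁, surface F, hF.nonempty, ?_⟩
  ext p
  simp only [Set.mem_iUnion, line, Set.mem_ofPred_eq, exists_prop]
  refine ⟨fun hp => ⟨p, hp, 0, by simp⟩, ?_⟩
  rintro ⟨a, ha, s, rfl⟩
  have hd : Polynomial.derivative (lineRestrict F a P₁) = 0 := by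
    have := congrArg (fun G => lineRestrict G a P₁) h
    simp only [lineRestrict, map_sum, map_mul, algHom_C, Polynomial.algebraMap_apply,
      Algebra.algebraMap_self, RingHom.id_apply, map_zero] at this
    rw [derivative_lineRestrict]
    exact this
  have hC := Polynomial.eq_C_of_natDegree_eq_zero (Polynomial.derivative_eq_zero.mp hd)
  have h0 := eval_lineRestrict F a P₁ 0
  have hs := eval_lineRestrict F a P₁ s
  rw [hC, Polynomial.eval_C] at h0 hs
  rw [hs, zero_smul, add_zero] at h0
  have ha' : aeval a F = 0 := by simpa using mem_surface.mp ha
  simpa [mem_surface] using h0.trans ha'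

end ConesAndCylinders

/-! ### Polynomials with constant coefficients -/

section Constants
variable {k K : Type*} [Field k] [Field K] [Algebra k K]

theorem mapCoeffs_lineRestrict_eq_zero (E : Derivation k K K) {a d : Fin 3 → K}
    (ha : vecDer E a = 0) (hd : vecDer E d = 0) (F : MvPolynomial (Fin 3) k) :
    E.mapCoeffs (lineRestrict F a d) = 0 := by
  have hC : ∀ u : K, E u = 0 → E.mapCoeffs (Polynomial.C u) = 0 := fun u hu => by
    rw [Derivation.mapCoeffs_C, hu, PolynomialModule.single_zero]
  have hmul : ∀ f g : Polynomial K, E.mapCoeffs f = 0 → E.mapCoeffs g = 0 →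
      E.mapCoeffs (f * g) = 0 := fun f g hf hg => by
    rw [Derivation.leibniz, hf, hg, smul_zero, smul_zero, add_zero]
  unfold lineRestrict
  induction F using MvPolynomial.induction_on with
  | C r => rw [algHom_C]; exact hC _ (E.map_algebraMap r)
  | add p q hp hq => rw [map_add, map_add, hp, hq, add_zero]
  | mul_X p i hp =>
    rw [map_mul, aeval_X]
    refine hmul _ _ hp ?_
    rw [map_add, hC _ (congrFun ha i), zero_add]
    exact hmul _ _ (hC _ (congrFun hd i)) E.mapCoeffs_X

/-- An element that is not a constant of `E` is transcendental over the constants of `E`. -/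
theorem polynomial_eq_zero_of_mapCoeffs_eq_zero [CharZero K] (E : Derivation k K K) {t : K}
    (ht : E t ≠ 0) (f : Polynomial K) (hf : E.mapCoeffs f = 0) (h : f.eval t = 0) : f = 0 := by
  induction hn : f.natDegree using Nat.strong_induction_on generalizing f with
  | _ n ih =>
    have hd : f.derivative.eval t = 0 := by
      have := E.apply_eval_eq t f
      rw [h, map_zero, hf, map_zero, zero_add, smul_eq_mul] at this
      exact (mul_eq_zero.mp this.symm).resolve_right ht
    have hd' : E.mapCoeffs f.derivative = 0 := by
      have hcoeff : ∀ i, E (f.coeff i) = 0 := fun i => by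
        have := Derivation.mapCoeffs_apply E f i
        rw [hf] at this
        exact this.symm
      ext i
      change E (f.derivative.coeff i) = 0
      rw [Polynomial.coeff_derivative, E.leibniz, hcoeff, smul_zero, add_zero, map_add,
        E.map_natCast, E.map_one_eq_zero, add_zero, smul_zero]
    have hconst : f.natDegree = 0 := by
      by_contra h0
      have h1 := ih f.derivative.natDegree (by
        rw [← hn]; exact Polynomial.natDegree_derivative_lt h0) f.derivative hd' hd rfl
      exact h0 (Polynomial.derivative_eq_zero.mp h1)
    rw [Polynomial.eq_C_of_natDegree_eq_zero hconst, Polynomial.eval_C] at h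
    rw [Polynomial.eq_C_of_natDegree_eq_zero hconst, h, Polynomial.C_0]

end Constants

/-! ### The function field of a developable surface -/

section FunctionField
variable {k K : Type u} [Field k] [Field K] [Algebra k K] {F : MvPolynomial (Fin 3) k}
  {x : Fin 3 → K}

theorem IsGenericPoint.aeval_eq_zero_iff_dvd (hx : IsGenericPoint (surface F) x)
    (hF : DefinesSurface F) (G : MvPolynomial (Fin 3) k) : aeval x G = 0 ↔ F ∣ G := by
  rw [hx.aeval_eq_zero_iff, hF.mem_vanishingIdeal_iff]

/-- The function field of a surface has transcendence degree at most two. -/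
theorem IsGenericPoint.trdeg_le_two (hx : IsGenericPoint (surface F) x) (hF : DefinesSurface F) :
    Algebra.trdeg k K ≤ 2 := by
  by_contra h
  have h3 : (3 : Cardinal) ≤ Algebra.trdeg k K := by
    have := Order.succ_le_of_lt (not_le.mp h)
    have h23 : Order.succ (2 : Cardinal.{u}) = 3 := by
      have := Cardinal.succ_natCast.{u} 2
      push_cast at this
      rw [this]
      norm_num
    rwa [h23] at this
  have halg := hx.isAlgebraic_range
  rw [← Algebra.adjoin_range_eq_range_aeval] at halg
  have hb : IsTranscendenceBasis k x :=
    Algebra.IsAlgebraic.isTranscendenceBasis_of_lift_le_trdeg_of_finite k x (by simpa using h3)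
  exact hF.1.ne_zero (hb.1.eq_zero_of_aeval_eq_zero F ((hx.aeval_eq_zero_iff_dvd hF F).mpr dvd_rfl))

theorem IsGenericPoint.gradAt_dotProduct_vecDer (hx : IsGenericPoint (surface F) x)
    (hF : DefinesSurface F) (D : Derivation k K K) : gradAt x F ⬝ᵥ vecDer D x = 0 := by
  rw [← derivation_aeval, (hx.aeval_eq_zero_iff_dvd hF F).mpr dvd_rfl, map_zero]

theorem IsGenericPoint.exists_derivation_of_orthogonal (hx : IsGenericPoint (surface F) x)
    (hF : DefinesSurface F) {v : Fin 3 → K} (hv : gradAt x F ⬝ᵥ v = 0) :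
    ∃ D : Derivation k K K, vecDer D x = v := by
  refine hx.exists_derivation v fun G hG => ?_
  obtain ⟨q, rfl⟩ := hF.mem_vanishingIdeal_iff.mp hG
  rw [gradAt_mul, (hx.aeval_eq_zero_iff_dvd hF F).mpr dvd_rfl, zero_smul, zero_add,
    smul_dotProduct, hv, smul_zero]

/-- On a surface that is not a cylinder, the coordinates of the normal vector are linearly
independent over `k`. -/
theorem IsGenericPoint.eq_zero_of_dotProduct_gradAt (hx : IsGenericPoint (surface F) x)
    (hF : DefinesSurface F)
    (hcyl : ¬ ∃ P₁ : Fin 3 → k, P₁ ≠ 0 ∧ ∑ i, C (P₁ i) * pderiv i F = 0) {a : Fin 3 → k}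
    (ha : (fun i => algebraMap k K (a i)) ⬝ᵥ gradAt x F = 0) : a = 0 := by
  by_contra h0
  refine hcyl ⟨a, h0, sum_C_mul_pderiv_eq_zero_of_dvd a ?_⟩
  rw [← hx.aeval_eq_zero_iff_dvd hF, ← ha]
  simp [dotProduct, gradAt]

/-- The rulings of a developable surface: the bordered Hessian yields a direction along which the
direction of the normal vector is constant. -/
theorem IsGenericPoint.exists_ruling (hx : IsGenericPoint (surface F) x) (hF : DefinesSurface F)
    (hdev : IsDevelopable F) (hn : gradAt x F ≠ 0) :
    ∃ (E : Derivation k K K) (c : K), vecDer E x ≠ 0 ∧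
      vecDer E (gradAt x F) = c • gradAt x F := by
  have hdet : aeval x (curvatureDet F) = 0 :=
    (hx.aeval_eq_zero_iff_dvd hF _).mpr (hF.dvd_of_forall_eval_eq_zero hdev)
  rw [curvatureDet, AlgHom.map_det] at hdet
  obtain ⟨u, hu, hMu⟩ := Matrix.exists_mulVec_eq_zero_iff.mpr hdet
  have h0 := congrFun hMu 0
  have h1 := congrFun hMu 1
  have h2 := congrFun hMu 2
  have h3 := congrFun hMu 3
  simp [Matrix.mulVec, dotProduct, Fin.sum_univ_four] at h0 h1 h2 h3
  obtain ⟨E, hE⟩ := hx.exists_derivation_of_orthogonal hF (v := ![u 0, u 1, u 2]) (by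
    simp only [dotProduct, Fin.sum_univ_three, gradAt, cons_val]
    linear_combination h3)
  have hEn : vecDer E (gradAt x F) = (-u 3) • gradAt x F := by
    ext i
    have : vecDer E (gradAt x F) i = gradAt x (pderiv i F) ⬝ᵥ ![u 0, u 1, u 2] := by
      rw [← hE]; exact derivation_aeval E x _
    rw [this, Pi.smul_apply, smul_eq_mul]
    fin_cases i <;> simp only [dotProduct, Fin.sum_univ_three, gradAt, cons_val, Fin.zero_eta,
      Fin.mk_one, Fin.reduceFinMk]
    · linear_combination h0
    · linear_combination h1
    · linear_combination h2
  refine ⟨E, -u 3, fun hE0 => ?_, hEn⟩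
  rw [hE] at hE0
  have hE1 : E = 0 := hx.derivation_ext fun i => by
    rw [Derivation.zero_apply]; exact (congrFun (hE.trans hE0) i)
  have h3' : u 3 = 0 := by
    obtain ⟨j, hj⟩ := Function.ne_iff.mp hn
    have := congrFun hEn j
    rw [hE1, Pi.smul_apply, smul_eq_mul] at this
    exact neg_eq_zero.mp ((mul_eq_zero.mp this.symm).resolve_right hj)
  refine hu (funext fun i => ?_)
  have g0 := congrFun hE0 0
  have g1 := congrFun hE0 1
  have g2 := congrFun hE0 2
  simp only [cons_val, Pi.zero_apply] at g0 g1 g2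
  fin_cases i <;> assumption

/-- Every nonzero derivation of the function field of a surface has a linearly independent
companion. -/
theorem IsGenericPoint.exists_independent (hx : IsGenericPoint (surface F) x)
    (hF : DefinesSurface F) (hn : gradAt x F ≠ 0) {E : Derivation k K K} (hE : vecDer E x ≠ 0) :
    ∃ T : Derivation k K K, ∀ a b : K, a • E + b • T = 0 → a = 0 ∧ b = 0 := by
  obtain ⟨l, hl⟩ := Function.ne_iff.mp hE
  obtain ⟨T, hT⟩ := hx.exists_derivation_of_orthogonal hF
    (v := gradAt x F ⨯₃ Pi.single l 1) (dot_self_cross _ _)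
  have hcross : vecDer E x ⨯₃ vecDer T x ≠ 0 := by
    rw [hT, cross_cross_eq_smul_sub_smul', hx.gradAt_dotProduct_vecDer hF, zero_smul, sub_zero,
      dotProduct_single_one]
    exact smul_ne_zero hl hn
  refine ⟨T, fun a b hab => ?_⟩
  have hv : a • vecDer E x + b • vecDer T x = 0 := funext fun i =>
    congrArg (fun D : Derivation k K K => D (x i)) hab
  have hb : b = 0 := by
    have := congrArg (fun w => vecDer E x ⨯₃ w) hv
    simp only [map_add, map_smul, cross_self, smul_zero, zero_add, map_zero] at this
    exact (smul_eq_zero.mp this).resolve_right hcross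
  rw [hb, zero_smul, add_zero] at hv
  exact ⟨(smul_eq_zero.mp hv).resolve_right hE, hb⟩

/-- The structure of a developable surface that is neither a cone nor a cylinder, at its generic
point `x`. The derivation `E` is along the ruling, the derivation `T` preserves the constants
of `E`, and `c` is the point of the ruling at which the tangent plane, as it varies with `T`,
meets its first two derivatives. The derivative of `c` has the direction of the ruling. -/
theorem IsGenericPoint.exists_focal_point [CharZero k] (hx : IsGenericPoint (surface F) x)
    (hF : DefinesSurface F) (hdev : IsDevelopable F)
    (hcone : ¬ ∃ P₀ : Fin 3 → k, ∀ p ∈ surface F, OnTangentPlane F p P₀)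
    (hcyl : ¬ ∃ P₁ : Fin 3 → k, P₁ ≠ 0 ∧ ∑ i, C (P₁ i) * pderiv i F = 0) :
    ∃ (E T : Derivation k K K) (c : Fin 3 → K) (t : K), vecDer E c = 0 ∧
      vecDer E (vecDer T c) = 0 ∧ vecDer T c ≠ 0 ∧ x = c + t • vecDer T c ∧ E t ≠ 0 := by
  set n := gradAt x F with hn_def
  have hn : n ≠ 0 := fun h0 => by
    have := hx.eq_zero_of_dotProduct_gradAt hF hcyl (a := 1) (by rw [← hn_def, h0, dotProduct_zero])
    exact one_ne_zero this
  have htr := hx.trdeg_le_two hF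
  obtain ⟨E, e, hE, hEn⟩ := hx.exists_ruling hF hdev hn
  obtain ⟨T₀, hT₀⟩ := hx.exists_independent hF hn hE
  have hE0 : E ≠ 0 := by rintro rfl; exact hE rfl
  obtain ⟨j, hj⟩ := Function.ne_iff.mp hn
  replace hj : n j ≠ 0 := hj
  -- the normal vector, scaled so that it is constant along the rulings
  set ν : Fin 3 → K := (n j)⁻¹ • n with hν_def
  have hEν : vecDer E ν = 0 := by
    ext i
    have : ν i = n i / n j := by rw [hν_def, Pi.smul_apply, smul_eq_mul, div_eq_inv_mul]
    rw [vecDer, this]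
    refine derivation_div_eq_zero E hj ?_
    have h1 : E (n i) = e * n i := congrFun hEn i
    have h2 : E (n j) = e * n j := congrFun hEn j
    rw [h1, h2]; ring
  have hdotν : ∀ a : Fin 3 → K, a ⬝ᵥ ν = 0 → a ⬝ᵥ n = 0 := fun a ha => by
    rw [hν_def, dotProduct_smul, smul_eq_mul] at ha
    exact (mul_eq_zero.mp ha).resolve_left (inv_ne_zero hj)
  have hνD : ∀ D : Derivation k K K, ν ⬝ᵥ vecDer D x = 0 := fun D => by
    rw [hν_def, smul_dotProduct, hx.gradAt_dotProduct_vecDer hF, smul_zero]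
  -- some coordinate of the normal direction is not constant, and `T` is scaled accordingly
  obtain ⟨i, hi⟩ : ∃ i, T₀ (ν i) ≠ 0 := by
    by_contra! h
    choose a ha using fun i => hx.exists_algebraMap_eq_of_isAlgebraic
      (isAlgebraic_of_derivation_eq_zero_pair htr hT₀ (congrFun hEν i) (h i))
    obtain ⟨b, hb, hab⟩ := exists_ne_zero_orthogonal a
    refine hb (hx.eq_zero_of_dotProduct_gradAt hF hcyl (hdotν _ ?_))
    have := congrArg (algebraMap k K) hab
    simp only [dotProduct, map_sum, map_mul, map_zero, ha] at this
    rw [dotProduct_comm]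
    exact this
  set T : Derivation k K K := (T₀ (ν i))⁻¹ • T₀ with hT_def
  have hTν : T (ν i) = 1 := by
    rw [hT_def, Derivation.smul_apply, smul_eq_mul, inv_mul_cancel₀ hi]
  have hconst : ∀ u, E u = 0 → T u = 0 → ∃ r, algebraMap k K r = u := fun u hEu hTu =>
    hx.exists_algebraMap_eq_of_isAlgebraic
      (isAlgebraic_of_derivation_eq_zero_pair htr hT₀ hEu (by
        rw [hT_def, Derivation.smul_apply, smul_eq_mul] at hTu
        exact (mul_eq_zero.mp hTu).resolve_left (inv_ne_zero hi)))
  -- `[E, T]` kills the transcendental element `ν i`, so it is a multiple of `E`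
  have hET : ∀ u, E u = 0 → E (T u) = 0 := by
    intro u hu
    by_contra hne
    have hindep : ∀ a b : K, a • E + b • ⁅E, T⁆ = 0 → a = 0 ∧ b = 0 := fun a b hab => by
      have h1 := congrArg (fun D : Derivation k K K => D u) hab
      simp only [Derivation.add_apply, Derivation.smul_apply, Derivation.commutator_apply, hu,
        map_zero, sub_zero, mul_zero, zero_add, Derivation.zero_apply, smul_eq_mul] at h1
      have hb : b = 0 := (mul_eq_zero.mp h1).resolve_right hne
      rw [hb, zero_smul, add_zero] at hab
      exact ⟨(smul_eq_zero.mp hab).resolve_right hE0, hb⟩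
    have halg := isAlgebraic_of_derivation_eq_zero_pair htr hindep (u := ν i) (congrFun hEν i) (by
      have h1 : E (ν i) = 0 := congrFun hEν i
      rw [Derivation.commutator_apply, hTν, h1, map_zero, E.map_one_eq_zero, sub_zero])
    rw [derivation_eq_zero_of_isAlgebraic_base T halg] at hTν
    exact zero_ne_one hTν
  have hETvec : ∀ a : Fin 3 → K, vecDer E a = 0 → vecDer E (vecDer T a) = 0 := fun a ha =>
    funext fun l => hET _ (congrFun ha l)
  have hEν' := hETvec _ hEν
  have hEν'' := hETvec _ hEν'
  have hw : ν ⬝ᵥ vecDer T ν ⨯₃ vecDer T (vecDer T ν) ≠ 0 := by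
    intro h0
    obtain ⟨P, hP, hPc, hPν⟩ := exists_constants_of_wronskian E T hET ν (congrFun hEν) h0
    choose a ha using fun l => hconst (P l) (hPc l).1 (hPc l).2
    obtain rfl : (fun l => algebraMap k K (a l)) = P := funext ha
    have := hx.eq_zero_of_dotProduct_gradAt hF hcyl (hdotν _ hPν)
    exact hP (by ext l; simp [this])
  obtain ⟨c, hc₀, hc₁, hc₂⟩ := exists_solution_of_triple_ne_zero hw (ν ⬝ᵥ x) (T (ν ⬝ᵥ x))
    (T (T (ν ⬝ᵥ x)))
  have hEw : E (ν ⬝ᵥ x) = 0 := by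
    rw [derivation_dotProduct, hνD, hEν, zero_dotProduct, add_zero]
  have hEc : vecDer E c = 0 := by
    refine eq_zero_of_triple_ne_zero hw ?_ ?_ ?_
    · have := derivation_dotProduct E ν c
      rw [hc₀, hEw, hEν, zero_dotProduct, add_zero] at this
      exact this.symm
    · have := derivation_dotProduct E (vecDer T ν) c
      rw [hc₁, hET _ hEw, hEν', zero_dotProduct, add_zero] at this
      exact this.symm
    · have := derivation_dotProduct E (vecDer T (vecDer T ν)) c
      rw [hc₂, hET _ (hET _ hEw), hEν'', zero_dotProduct, add_zero] at this
      exact this.symm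
  have hν'x : vecDer T ν ⬝ᵥ x = T (ν ⬝ᵥ x) := by
    rw [derivation_dotProduct, hνD, zero_add]
  have hνc' : ν ⬝ᵥ vecDer T c = 0 := by
    have := derivation_dotProduct T ν c
    rw [hc₀, hc₁] at this
    exact right_eq_add.mp this
  have hν'c' : vecDer T ν ⬝ᵥ vecDer T c = 0 := by
    have := derivation_dotProduct T (vecDer T ν) c
    rw [hc₁, hc₂] at this
    exact right_eq_add.mp this
  have hc' : vecDer T c ≠ 0 := by
    intro h0
    choose a ha using fun l => hconst (c l) (congrFun hEc l) (congrFun h0 l)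
    refine hcone ⟨a, fun p hp => ?_⟩
    have h1 : aeval x (∑ l, pderiv l F * (C (a l) - X l)) = 0 := by
      have h2 : (c - x) ⬝ᵥ n = 0 := hdotν _ (by
        rw [dotProduct_comm, dotProduct_sub, hc₀, sub_self])
      rw [← h2, dotProduct_comm]
      simp [dotProduct, ha, hn_def, gradAt]
    have h3 := hx.eval_eq_zero h1 hp
    simpa [OnTangentPlane, dotProduct, gradient] using h3
  have hcross : ν ⨯₃ vecDer T ν ≠ 0 := fun h0 => hw (by
    rw [triple_product_permutation, triple_product_permutation, h0, dotProduct_zero])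
  obtain ⟨t, ht⟩ := exists_eq_smul_of_orthogonal hcross hc' hνc' hν'c' (v := x - c)
    (by rw [dotProduct_sub, hc₀, sub_self]) (by rw [dotProduct_sub, hc₁, hν'x, sub_self])
  have hxt : x = c + t • vecDer T c := by rw [← ht, add_sub_cancel]
  refine ⟨E, T, c, t, hEc, hETvec _ hEc, hc', hxt, fun hEt => hE ?_⟩
  ext l
  have h1 : E (x l) = E (c l) + E (t * T (c l)) := by
    rw [← map_add]; exact congrArg E (congrFun hxt l)
  have h2 : E (c l) = 0 := congrFun hEc l
  have h3 : E (T (c l)) = 0 := hET _ h2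
  rw [vecDer, h1, E.leibniz, h2, h3, hEt, smul_zero, smul_zero, add_zero, add_zero]
  rfl

end FunctionField

/-! ### The cuspidal edge -/

section CuspidalEdge

/-- A curve is smooth outside a proper closed subset. -/
theorem exists_smooth_of_trdeg_eq_one {k : Type u} [Field k] [CharZero k] {Γ : Set (Fin 3 → k)}
    (hprime : (vanishingIdeal k Γ : Ideal (MvPolynomial (Fin 3) k)).IsPrime)
    (htr : Algebra.trdeg k (MvPolynomial (Fin 3) k ⧸
      (vanishingIdeal k Γ : Ideal (MvPolynomial (Fin 3) k))) = 1) :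
    ∃ m : MvPolynomial (Fin 3) k, m ∉ vanishingIdeal k Γ ∧
      ∀ q ∈ Γ, eval q m ≠ 0 → Module.finrank k (tangentSpace Γ q) = 1 := by
  obtain ⟨L, _, _, y, hy, hfin⟩ := exists_isGenericPoint Γ hprime
  rw [← hy.trdeg_eq] at htr
  obtain ⟨D, hD⟩ := exists_derivation_ne_zero (k := k) (K := L) (by rw [htr]; exact one_ne_zero)
  obtain ⟨m, hm, h⟩ := hy.eventually_smooth htr.le hD
  exact ⟨m, fun h0 => hm ((hy.aeval_eq_zero_iff m).mpr h0), h⟩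

variable {k K : Type u} [Field k] [Field K] [Algebra k K]

theorem one_le_trdeg_range [CharZero k] {c : Fin 3 → K} {T : Derivation k K K}
    (hT : vecDer T c ≠ 0) :
    1 ≤ Algebra.trdeg k (aeval c : MvPolynomial (Fin 3) k →ₐ[k] K).range := by
  rw [Cardinal.one_le_iff_ne_zero]
  intro h0
  have halg : Algebra.IsAlgebraic k (aeval c : MvPolynomial (Fin 3) k →ₐ[k] K).range :=
    trdeg_eq_zero_iff.mp h0
  refine hT (funext fun i => derivation_eq_zero_of_isAlgebraic_base T ?_)
  have := halg.isAlgebraic ⟨c i, X i, aeval_X _ _⟩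
  exact this.algebraMap (A := K)

theorem trdeg_range_le_one [CharZero k] (htr : Algebra.trdeg k K ≤ 2) {c : Fin 3 → K}
    {E : Derivation k K K} (hE : E ≠ 0) (hEc : vecDer E c = 0) :
    Algebra.trdeg k (aeval c : MvPolynomial (Fin 3) k →ₐ[k] K).range ≤ 1 := by
  set S := (aeval c : MvPolynomial (Fin 3) k →ₐ[k] K).range with hS
  have hES : ∀ a ∈ S, E a = 0 := by
    rintro _ ⟨G, rfl⟩
    exact (derivation_aeval E c G).trans (by rw [hEc, dotProduct_zero])
  have h1 : 1 ≤ Algebra.trdeg S K := by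
    rw [Cardinal.one_le_iff_ne_zero]
    intro h0
    have halg : Algebra.IsAlgebraic S K := trdeg_eq_zero_iff.mp h0
    exact hE (Derivation.ext fun u =>
      derivation_eq_zero_of_isAlgebraic E S hES (halg.isAlgebraic u))
  have h2 := trdeg_add_eq k S (A := K)
  have h3 : Algebra.trdeg k S + 1 ≤ 1 + 1 := by
    rw [one_add_one_eq_two]
    exact ((add_le_add_right h1 _).trans h2.le).trans htr
  exact (Cardinal.add_one_le_add_one_iff).mp h3

variable {F : MvPolynomial (Fin 3) k} {x c : Fin 3 → K}

/-- The image of the generic point of `Z` under a rational map is a generic point, up to the choice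
of the field, of the Zariski closure of the image of the map. -/
theorem IsGenericPoint.aeval_eq_zero_iff_mem_vanishingIdeal_zeroLocus_ker {Z : Set (Fin 3 → k)}
    (hx : IsGenericPoint Z x) (c : Fin 3 → K) (G : MvPolynomial (Fin 3) k) :
    aeval c G = 0 ↔ G ∈ vanishingIdeal k (zeroLocus k
      (RingHom.ker (aeval c : MvPolynomial (Fin 3) k →ₐ[k] K))) := by
  refine ⟨fun h => le_vanishingIdeal_zeroLocus _ ((RingHom.mem_ker).mpr h), fun h =>
    hx.eq_zero_of_eventually ?_⟩
  filter_upwards [eventually_mem, hx.eventually_specializesTo_vec c] with p hp ⟨q, hq⟩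
  have hqΓ : q ∈ zeroLocus k (RingHom.ker (aeval c : MvPolynomial (Fin 3) k →ₐ[k] K)) := by
    intro H hH
    have h1 := SpecializesTo.aeval hq H
    rw [show aeval c H = 0 from hH] at h1
    simpa using hx.eq_zero_of_specializesTo hp h1
  have h2 : eval q G = 0 := by simpa using h q hqΓ
  rw [← h2]
  exact SpecializesTo.aeval hq G

/-- The focal points of the rulings of a developable surface form a curve whose tangents are the
rulings. -/
theorem IsGenericPoint.isCuspidalEdge [CharZero k] (hx : IsGenericPoint (surface F) x)
    (hF : DefinesSurface F)
    (hcyl : ¬ ∃ P₁ : Fin 3 → k, P₁ ≠ 0 ∧ ∑ i, C (P₁ i) * pderiv i F = 0)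
    {E T : Derivation k K K} {t : K} (hEc : vecDer E c = 0) (hEc' : vecDer E (vecDer T c) = 0)
    (hc' : vecDer T c ≠ 0) (hxc : x = c + t • vecDer T c) (ht : E t ≠ 0) :
    IsCuspidalEdge (zeroLocus k (RingHom.ker (aeval c : MvPolynomial (Fin 3) k →ₐ[k] K)))
      (surface F) := by
  have : CharZero K := charZero_of_injective_algebraMap (algebraMap k K).injective
  set Γ := zeroLocus k (RingHom.ker (aeval c : MvPolynomial (Fin 3) k →ₐ[k] K)) with hΓ
  have hcΓ : ∀ G, aeval c G = 0 ↔ G ∈ vanishingIdeal k Γ :=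
    hx.aeval_eq_zero_iff_mem_vanishingIdeal_zeroLocus_ker c
  have hI : (vanishingIdeal k Γ : Ideal (MvPolynomial (Fin 3) k)) =
      RingHom.ker (aeval c : MvPolynomial (Fin 3) k →ₐ[k] K) := by
    ext G; rw [← hcΓ, RingHom.mem_ker]
  have hprime : (vanishingIdeal k Γ : Ideal (MvPolynomial (Fin 3) k)).IsPrime := by
    rw [hI]; exact RingHom.ker_isPrime _
  have hE : E ≠ 0 := by rintro rfl; exact ht rfl
  have htr : Algebra.trdeg k (MvPolynomial (Fin 3) k ⧸
      (vanishingIdeal k Γ : Ideal (MvPolynomial (Fin 3) k))) = 1 := by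
    rw [trdeg_quotient_eq_trdeg_range c _ hcΓ]
    exact le_antisymm (trdeg_range_le_one (hx.trdeg_le_two hF) hE hEc) (one_le_trdeg_range hc')
  have hgrad : ∀ G ∈ vanishingIdeal k Γ, gradAt c G ⬝ᵥ vecDer T c = 0 := fun G hG => by
    rw [← derivation_aeval, (hcΓ G).mpr hG, map_zero]
  -- the whole tangent at the generic point of `Γ` lies on the surface
  have hline : lineRestrict F c (vecDer T c) = 0 := by
    refine polynomial_eq_zero_of_mapCoeffs_eq_zero E ht _
      (mapCoeffs_lineRestrict_eq_zero E hEc hEc' F) ?_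
    rw [eval_lineRestrict, ← hxc]
    exact (hx.aeval_eq_zero_iff_dvd hF F).mpr dvd_rfl
  refine ⟨⟨by rw [hI], hprime, htr, ?_⟩, ?_⟩
  · rintro ⟨a, b, ha, hab⟩
    -- a plane that contains `Γ` contains its tangents, so its normal is normal to the surface
    have h1 : aeval c (∑ i, C (a i) * X i - C b) = 0 := (hcΓ _).mpr fun q hq => by
      have := hab q hq
      simp only [dotProduct] at this
      simp [this]
    rw [map_sub, ← dotProduct_algebraMap_eq_aeval, sub_eq_zero] at h1
    set α : Fin 3 → K := fun i => algebraMap k K (a i) with hα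
    have hαD : ∀ D : Derivation k K K, vecDer D α = 0 := fun D =>
      funext fun i => D.map_algebraMap _
    have hb : ∀ D : Derivation k K K, D (aeval c (C b : MvPolynomial (Fin 3) k)) = 0 := fun D => by
      rw [algHom_C]; exact D.map_algebraMap b
    have h2 : α ⬝ᵥ vecDer T c = 0 := by
      have := derivation_dotProduct T α c
      rw [h1, hb, hαD, zero_dotProduct, add_zero] at this
      exact this.symm
    have h3 : α ⬝ᵥ x = aeval c (C b : MvPolynomial (Fin 3) k) := by
      rw [hxc, dotProduct_add, dotProduct_smul, h2, smul_zero, add_zero, h1]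
    have h4 : ∀ D : Derivation k K K, α ⬝ᵥ vecDer D x = 0 := fun D => by
      have := derivation_dotProduct D α x
      rw [h3, hb, hαD, zero_dotProduct, add_zero] at this
      exact this.symm
    have hn : gradAt x F ≠ 0 := fun h0 => one_ne_zero
      (hx.eq_zero_of_dotProduct_gradAt hF hcyl (a := 1) (by rw [h0, dotProduct_zero]))
    have h5 : gradAt x F ⨯₃ α = 0 := by
      ext i
      obtain ⟨D, hD⟩ := hx.exists_derivation_of_orthogonal hF
        (v := gradAt x F ⨯₃ Pi.single i 1) (dot_self_cross _ _)
      have := h4 D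
      rw [hD, triple_product_permutation, triple_product_permutation, single_one_dotProduct] at this
      rw [← cross_anticomm, Pi.neg_apply, this, neg_zero, Pi.zero_apply]
    obtain ⟨s, hs⟩ := exists_eq_smul_of_cross_eq_zero hn h5
    obtain ⟨e, he, hae⟩ := exists_ne_zero_orthogonal a
    refine he (hx.eq_zero_of_dotProduct_gradAt hF hcyl ?_)
    have hs0 : s ≠ 0 := by
      rintro rfl
      refine ha (funext fun i => (algebraMap k K).injective ?_)
      have := congrFun hs i
      simpa [hα] using this
    have h6 : (fun i => algebraMap k K (e i)) ⬝ᵥ α = 0 := by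
      have := congrArg (algebraMap k K) hae
      rw [dotProduct_comm]
      simpa [dotProduct, hα] using this
    rw [hs, dotProduct_smul, smul_eq_mul] at h6
    exact (mul_eq_zero.mp h6).resolve_left hs0
  · suffices h : (vanishingIdeal k (tangentLines Γ) : Ideal (MvPolynomial (Fin 3) k)) =
        Ideal.span {F} by
      rw [h, zeroLocus_span]
      ext p
      simp [mem_surface]
    refine le_antisymm (fun G hG => ?_) ?_
    · -- a general point of the surface lies on a tangent of `Γ`
      obtain ⟨m, hm, hsmooth⟩ := exists_smooth_of_trdeg_eq_one hprime htr
      rw [← hcΓ] at hm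
      rw [Ideal.mem_span_singleton, ← hx.aeval_eq_zero_iff_dvd hF]
      refine hx.aeval_eq_zero_of_eventually ?_
      filter_upwards [eventually_mem, hx.eventually_specializesTo_vec c,
        hx.eventually_specializesTo_vec (vecDer T c), hx.eventually_specializesTo t,
        hx.eventually_ne_zero hm] with p hp ⟨q, hq⟩ ⟨r, hr⟩ ⟨τ, hτ⟩ hmq
      have hqΓ : q ∈ Γ := fun H hH => by
        have h1 := SpecializesTo.aeval hq H
        rw [show aeval c H = 0 from hH] at h1
        simpa using hx.eq_zero_of_specializesTo hp h1
      have hpq : p - q = τ • r := by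
        ext i
        have h1 : SpecializesTo x p (x i) (p i) := by
          simpa using SpecializesTo.aeval_eval (x := x) (p := p) (X i)
        have h2 : SpecializesTo x p (x i) (q i + τ * r i) := by
          have h3 : x i = c i + t * vecDer T c i := congrFun hxc i
          rw [h3]
          exact (hq i).add (hτ.mul (hr i))
        rw [Pi.sub_apply, hx.specializesTo_unique hp h1 h2, add_sub_cancel_left]
        rfl
      have hrq : r ∈ tangentSpace Γ q := fun G hG => by
        have h1 : SpecializesTo x p (gradAt c G ⬝ᵥ vecDer T c) (gradient G q ⬝ᵥ r) :=
          SpecializesTo.dotProduct (fun i => SpecializesTo.aeval hq _) hr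
        rw [hgrad G hG] at h1
        exact hx.eq_zero_of_specializesTo hp h1
      have hmem : p ∈ tangentLines Γ :=
        ⟨q, hqΓ, hsmooth q hqΓ (hmq _ (SpecializesTo.aeval hq m)), by
          rw [hpq]; exact (tangentSpace Γ q).smul_mem τ hrq⟩
      simpa using hG p hmem
    · rw [Ideal.span_singleton_le_iff_mem]
      rintro p ⟨q, hq, hfin, hpq⟩
      -- near `q`, the tangent direction of `Γ` is the cross product of two gradients
      obtain ⟨G₁, hG₁, G₂, hG₂, hne⟩ := exists_gradient_cross_ne_zero hfin
      obtain ⟨μ, hμ⟩ := exists_eq_smul_of_orthogonal hne hne (dot_self_cross _ _)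
        (dot_cross_self _ _) (hpq G₁ hG₁) (hpq G₂ hG₂)
      let w : Fin 3 → MvPolynomial (Fin 3) k := (fun i => pderiv i G₁) ⨯₃ (fun i => pderiv i G₂)
      let Φ : MvPolynomial (Fin 3) k := aeval (fun i => X i + C μ * w i) F
      have hwc : (fun i => aeval c (w i)) = gradAt c G₁ ⨯₃ gradAt c G₂ := funext fun i =>
        map_crossProduct (aeval c : MvPolynomial (Fin 3) k →ₐ[k] K).toRingHom _ _ i
      have hwq : (fun i => eval q (w i)) = gradient G₁ q ⨯₃ gradient G₂ q := funext fun i =>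
        map_crossProduct (eval q) _ _ i
      obtain ⟨κ, hκ⟩ : ∃ κ : K, gradAt c G₁ ⨯₃ gradAt c G₂ = κ • vecDer T c := by
        by_cases h0 : gradAt c G₁ ⨯₃ gradAt c G₂ = 0
        · exact ⟨0, by rw [h0, zero_smul]⟩
        · exact exists_eq_smul_of_orthogonal h0 hc' (hgrad G₁ hG₁) (hgrad G₂ hG₂)
            (dot_self_cross _ _) (dot_cross_self _ _)
      have hΦ : aeval c Φ = 0 := by
        have h1 : aeval c Φ = aeval (c + (algebraMap k K μ * κ) • vecDer T c) F := by
          rw [mul_smul, ← hκ, ← hwc]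
          simp only [Φ, ← AlgHom.comp_apply, comp_aeval]
          congr 2
          ext i
          simp [Algebra.smul_def]
        rw [h1, ← eval_lineRestrict, hline, Polynomial.eval_zero]
      have h2 := (hcΓ Φ).mp hΦ q hq
      have h3 : aeval q Φ = aeval p F := by
        have hp : p = q + μ • fun i => eval q (w i) := by rw [hwq, ← hμ, add_sub_cancel]
        simp only [Φ, ← AlgHom.comp_apply, comp_aeval]
        congr 2
        rw [hp]
        ext i
        simp
      rw [← h3, h2]

end CuspidalEdge

end DevelopableSurface

theorem mainTheorem4 {𝕜 : Type*} [Field 𝕜] [CharZero 𝕜] (F : MvPolynomial (Fin 3) 𝕜)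
    (hF : DevelopableSurface.DefinesSurface F) (hdev : DevelopableSurface.IsDevelopable F) :
    (∀ P₀ : Fin 3 → 𝕜,
      (∀ p ∈ DevelopableSurface.surface F, DevelopableSurface.OnTangentPlane F p P₀) →
        DevelopableSurface.IsConicalSurface (DevelopableSurface.surface F) P₀) ∧
    (∀ P₁ : Fin 3 → 𝕜, P₁ ≠ 0 →
      (∑ i, MvPolynomial.C (P₁ i) * MvPolynomial.pderiv i F = 0) →
        DevelopableSurface.IsCylindricalSurface (DevelopableSurface.surface F) P₁) ∧
    ((¬ ∃ P₀ : Fin 3 → 𝕜,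
        ∀ p ∈ DevelopableSurface.surface F, DevelopableSurface.OnTangentPlane F p P₀) →
      (¬ ∃ P₁ : Fin 3 → 𝕜, P₁ ≠ 0 ∧
        ∑ i, MvPolynomial.C (P₁ i) * MvPolynomial.pderiv i F = 0) →
      DevelopableSurface.IsTangentialSurface (DevelopableSurface.surface F) ∧
      ∀ Γ : Set (Fin 3 → 𝕜),
        DevelopableSurface.IsCuspidalEdge Γ (DevelopableSurface.surface F) →
          Γ ⊆ DevelopableSurface.singularSet F) := by
  refine ⟨fun P₀ h => DevelopableSurface.isConicalSurface_of_onTangentPlane hF P₀ h,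
    fun P₁ hP₁ h => DevelopableSurface.isCylindricalSurface_of_sum_pderiv_eq_zero hF P₁ hP₁ h,
    fun hcone hcyl => ⟨?_, fun Γ hΓ => hΓ.subset_singularSet⟩⟩
  have hprime : (MvPolynomial.vanishingIdeal 𝕜 (DevelopableSurface.surface F) :
      Ideal (MvPolynomial (Fin 3) 𝕜)).IsPrime := by
    rw [hF.2]
    exact (Ideal.span_singleton_prime hF.1.ne_zero).mpr hF.1.prime
  obtain ⟨K, _, _, x, hx, -⟩ := DevelopableSurface.exists_isGenericPoint _ hprime
  obtain ⟨E, T, c, t, hEc, hEc', hc', hxc, ht⟩ := hx.exists_focal_point hF hdev hcone hcyl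
  exact ⟨_, hx.isCuspidalEdge hF hcyl hEc hEc' hc' hxc ht⟩
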